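/- **Model.** For integers $n,m,s\ge 1$ and a probability distribution $P$ on $\{0,1,\dots,m\}$, let $D_1,\dots,D_n$ be independent random subsets of an $m$-element set $W$ with $\mathbb P(D_i=A)=P(|A|)\binom{m}{|A|}^{-1}$ for every $A\subseteq W$. The active random intersection graph $G_s(n,m,P)$ has vertices $v_1,\dots,v_n$, and distinct $v_i,v_j$ are adjacent (written $v_i\sim v_j$) if and only if $|D_i\cap D_j|\ge s$. Let $d(v)$ denote the degree of $v$. For an integer $k$ and distinct vertices $v,v',v''$ put $$\alpha^{[k]}_s(m,P)=\mathbb P\bigl(v'\sim v''\,\big|\,v\sim v',\ v\sim v'',\ d(v)=k\bigr)$$ (by symmetry this does not depend on the choice of $v,v',v''$). Let $X_1=|D_1|$, which has distribution $P$, and $Z_{m1}=\binom ms^{-1/2}n^{1/2}\binom{X_1}{s}$. **Theorem.** Let $\beta>0$ and let $m\to\infty$, where $n=n_m$, $s=s_m\ge1$ and $P=P_m$ may depend on $m$. Assume that $s=O(1)$ and $\binom ms n^{-1}\to\beta$ (so that $n\to\infty$), that $Z_{m1}$ converges in distribution to a random variable $Z$, that $0<\mathbb E Z^2<\infty$, and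 that $\mathbb E Z_{m1}^2\to\mathbb E Z^2$. Put $\mu=\mathbb E Z$ and $$p_k=\frac1{k!}\,\mathbb E\bigl((Z\mu)^k e^{-Z\mu}\bigr),\qquad k=0,1,2,\dots .$$ Then for every fixed $k=2,3,\dots$ we have $p_k>0$, the conditional probability $\alpha^{[k]}_s(m,P)$ is well defined (its conditioning event has positive probability) for all sufficiently large $m$, and, as $m\to\infty$, $$\alpha^{[k]}_s(m,P)=\frac1k\,\frac{\mathbb E Z}{\sqrt\beta}\,\frac{p_{k-1}}{p_k}+o(1).$$ -/

import Mathlib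

open MeasureTheory ProbabilityTheory Filter Topology

noncomputable section

namespace ActiveGraph

/-- The size `|A|` of a set `A ⊆ W = Fin m`, as an element of `{0, 1, …, m}`. -/
def size {m : ℕ} (A : Finset (Fin m)) : Fin (m + 1) :=
  ⟨A.card, Nat.lt_succ_of_le (card_finset_fin_le A)⟩

/-- The weights `P(|A|) / (m choose |A|)`, `A ⊆ W`, sum up to one. -/
theorem sum_weights (m : ℕ) (P : PMF (Fin (m + 1))) :
    ∑ A : Finset (Fin m), P (size A) / (m.choose A.card : ENNReal) = 1 := by
  rw [← Finset.sum_fiberwise Finset.univ size]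
  have h2 : ∀ i : Fin (m + 1), ∑ A : Finset (Fin m) with size A = i,
      P (size A) / (m.choose A.card : ENNReal) = P i := by
    intro i
    have hc : (m.choose (i : ℕ) : ENNReal) ≠ 0 := by
      exact_mod_cast (Nat.choose_pos (Nat.lt_succ_iff.mp i.isLt)).ne'
    have hset : Finset.univ.filter (fun A : Finset (Fin m) => size A = i)
        = Finset.powersetCard (i : ℕ) Finset.univ := by
      ext A
      simp [size, Fin.ext_iff, Finset.mem_powersetCard]
    have hsum : ∑ A : Finset (Fin m) with size A = i,
        P (size A) / (m.choose A.card : ENNReal)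
        = ∑ A : Finset (Fin m) with size A = i, P i / (m.choose (i : ℕ) : ENNReal) := by
      refine Finset.sum_congr rfl fun A hA => ?_
      have hA' : size A = i := (Finset.mem_filter.mp hA).2
      have hcard : A.card = (i : ℕ) := congrArg Fin.val hA'
      rw [hA', hcard]
    rw [hsum, Finset.sum_const, hset, Finset.card_powersetCard, Finset.card_univ,
      Fintype.card_fin, nsmul_eq_mul, ENNReal.mul_div_cancel hc (ENNReal.natCast_ne_top _)]
  rw [Finset.sum_congr rfl (fun i _ => h2 i)]
  simpa [tsum_fintype] using P.tsum_coe

/-- The law of one random attribute set `D ⊆ W = Fin m`, where `P` is a probability on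
`{0, 1, …, m}`: `ℙ(D = A) = P(|A|) / (m choose |A|)`. -/
def attributeLaw (m : ℕ) (P : PMF (Fin (m + 1))) : PMF (Finset (Fin m)) :=
  PMF.ofFintype (fun A => P (size A) / (m.choose A.card : ENNReal)) (sum_weights m P)

/-- The joint law of the independent, identically distributed attribute sets
`D = (D₁, …, Dₙ)` of the `n` actors. -/
def setsLaw (n m : ℕ) (P : PMF (Fin (m + 1))) : Measure (Fin n → Finset (Fin m)) :=
  Measure.pi (fun _ : Fin n => (attributeLaw m P).toMeasure)

/-- The active intersection graph of the attribute sets `D`: two distinct actors are adjacent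
if and only if they share at least `s` attributes. With `D` distributed according to
`setsLaw n m P`, this is the active random intersection graph `G_s(n, m, P)`. -/
def graph {n m : ℕ} (s : ℕ) (D : Fin n → Finset (Fin m)) : SimpleGraph (Fin n) where
  Adj i j := i ≠ j ∧ s ≤ (D i ∩ D j).card
  symm := ⟨fun i j h => ⟨h.1.symm, by rw [Finset.inter_comm]; exact h.2⟩⟩
  loopless := ⟨fun _ h => h.1 rfl⟩

instance {n m : ℕ} (s : ℕ) (D : Fin n → Finset (Fin m)) : DecidableRel (graph s D).Adj :=
  fun i j => inferInstanceAs (Decidable (i ≠ j ∧ s ≤ (D i ∩ D j).card))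

/-- The event `{v ∼ v', v ∼ v'', d(v) = k}` in `G_s(n, m, P)`. -/
def cherryEvent {n m : ℕ} (s k : ℕ) (v v' v'' : Fin n) : Set (Fin n → Finset (Fin m)) :=
  {D | (graph s D).Adj v v' ∧ (graph s D).Adj v v'' ∧ (graph s D).degree v = k}

/-- The conditional probability
`α^[k] = ℙ(v' ∼ v'' | v ∼ v', v ∼ v'', d(v) = k)` in `G_s(n, m, P)`. -/
def alphaDeg (n m s : ℕ) (P : PMF (Fin (m + 1))) (k : ℕ) (v v' v'' : Fin n) : ℝ :=
  ((setsLaw n m P)[|cherryEvent s k v v' v'']).real {D | (graph s D).Adj v' v''}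

/-- The rescaled number of joints `(m choose s)^(-1/2) * n^(1/2) * (x choose s)` of a vertex whose
attribute set has size `x`. When `x` is distributed according to `P`, this is the
random variable `Z_{m1}`. -/
def scaledJoints (n m s : ℕ) (x : Fin (m + 1)) : ℝ :=
  (Real.sqrt (m.choose s))⁻¹ * Real.sqrt n * ((x : ℕ).choose s : ℝ)

/-- The mixed Poisson probabilities `p_k = (k!)⁻¹ E((Z μ)^k e^{-Z μ})`, where `μ = E Z`. -/
def mixedPoisson {Ω : Type*} [MeasurableSpace Ω] (Pr : Measure Ω) (Z : Ω → ℝ) (k : ℕ) : ℝ :=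
  (k.factorial : ℝ)⁻¹ *
    ∫ ω, (Z ω * ∫ ω', Z ω' ∂Pr) ^ k * Real.exp (-(Z ω * ∫ ω', Z ω' ∂Pr)) ∂Pr

end ActiveGraph

end

/-!
# Clustering at vertices of given degree in active random intersection graphs

Condition on the attribute set `D v = A` of the root. The other vertices are then adjacent to `v`
independently with probability `q = edgeProb P s A`, so that the cherry event has conditional
probability `(n-3).choose (k-2) * q ^ k * (1 - q) ^ (n - 1 - k)`, and the cherry event together with
`v' ∼ v''` has the same probability with `q ^ 2` replaced by `triangleProb P s A`
(`setsLaw_cherry`).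

Let `y = |A|.choose s` be the number of joints (`s`-subsets) of `A`, and let `c = μ / √β`. By
Bonferroni, `q` is approximately `y` times the probability `meanContain P s` that a random set
contains a given joint, hence `n q → y c`. A triangle arises mainly when the sets of `v'` and `v''`
contain the same joint of `A`, so `n ^ 2 * triangleProb P s A → y c ^ 2`. All the errors involve
the probability of containing `s + 1` given attributes, which the second moment of the number of
joints bounds by `O(1 / (n m))` (`meanContain_succ_le`), thanks to
`(x.choose s) * (x - s) ≤ (x.choose s) ^ 2`; in particular the sets `D v'` and `D v''` need not be
truncated.

The limits are uniform over the sets `A` with a given number of joints (`jointsFilter`), and the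
rescaled conditional probabilities are bounded uniformly in `A` (`binomial_weight_le`). Therefore
averaging over `A` and convergence in distribution give (`tendsto_sum_weight`)
`n ^ 2 ℙ(cherry) → 𝔼 (Zμ) ^ k e ^ (-Zμ) / (k - 2)!` and
`n ^ 2 ℙ(cherry, v' ∼ v'') → (μ / √β) 𝔼 (Zμ) ^ (k - 1) e ^ (-Zμ) / (k - 2)!`,
whose ratio is the claim.
-/

noncomputable section

namespace ActiveGraph

/-! ### Sums over one attribute set -/

/-- The probability `ℙ(D = A)` as a real number. -/
def weight {m : ℕ} (P : PMF (Fin (m + 1))) (A : Finset (Fin m)) : ℝ :=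
  (attributeLaw m P A).toReal

lemma weight_nonneg {m : ℕ} (P : PMF (Fin (m + 1))) (A : Finset (Fin m)) : 0 ≤ weight P A :=
  ENNReal.toReal_nonneg

lemma sum_weight {m : ℕ} (P : PMF (Fin (m + 1))) : ∑ A, weight P A = 1 := by
  have h := (attributeLaw m P).tsum_coe
  rw [tsum_fintype] at h
  simp only [weight]
  rw [← ENNReal.toReal_sum (fun A _ => (attributeLaw m P).apply_ne_top A), h, ENNReal.toReal_one]

lemma weight_eq {m : ℕ} (P : PMF (Fin (m + 1))) (A : Finset (Fin m)) :
    weight P A = (P (size A)).toReal / (m.choose A.card : ℝ) := by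
  simp [weight, attributeLaw, ENNReal.toReal_div]

/-- A sum of weights may be evaluated by grouping the sets according to their size. -/
lemma sum_weight_mul_eq {m : ℕ} (P : PMF (Fin (m + 1))) (F : Finset (Fin m) → ℝ)
    (φ : Fin (m + 1) → ℝ)
    (h : ∀ x : Fin (m + 1), ∑ A ∈ Finset.powersetCard (x : ℕ) Finset.univ, F A =
      (m.choose (x : ℕ) : ℝ) * φ x) :
    ∑ A, weight P A * F A = ∑ x, (P x).toReal * φ x := by
  rw [← Finset.sum_fiberwise Finset.univ size]
  refine Finset.sum_congr rfl fun x _ => ?_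
  have hc : (m.choose (x : ℕ) : ℝ) ≠ 0 := by
    exact_mod_cast (Nat.choose_pos (Nat.lt_succ_iff.mp x.isLt)).ne'
  have hset : Finset.univ.filter (fun A : Finset (Fin m) => size A = x)
      = Finset.powersetCard (x : ℕ) Finset.univ := by
    ext A
    simp [size, Fin.ext_iff, Finset.mem_powersetCard]
  rw [hset]
  calc ∑ A ∈ Finset.powersetCard (x : ℕ) Finset.univ, weight P A * F A
      = ∑ A ∈ Finset.powersetCard (x : ℕ) Finset.univ,
          (P x).toReal / (m.choose (x : ℕ) : ℝ) * F A := by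
        refine Finset.sum_congr rfl fun A hA => ?_
        have hA' : A.card = (x : ℕ) := (Finset.mem_powersetCard.mp hA).2
        have hs : size A = x := Fin.ext hA'
        rw [weight_eq, hs, hA']
    _ = (P x).toReal * φ x := by
        rw [← Finset.mul_sum, h x]
        field_simp

/-- The size of a random attribute set has law `P`. -/
lemma sum_weight_mul_size {m : ℕ} (P : PMF (Fin (m + 1))) (φ : Fin (m + 1) → ℝ) :
    ∑ A, weight P A * φ (size A) = ∫ x, φ x ∂P.toMeasure := by
  rw [PMF.integral_eq_sum]
  simp only [smul_eq_mul]
  refine sum_weight_mul_eq P _ φ fun x => ?_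
  rw [Finset.sum_congr rfl (g := fun _ => φ x) (fun A hA => ?_)]
  · simp [Finset.card_powersetCard]
  · have : size A = x := Fin.ext (Finset.mem_powersetCard.mp hA).2
    simp [this]

/-- The probability that a random attribute set contains the fixed set `J`. -/
def containProb {m : ℕ} (P : PMF (Fin (m + 1))) (J : Finset (Fin m)) : ℝ :=
  ∑ B, weight P B * if J ⊆ B then 1 else 0

lemma containProb_nonneg {m : ℕ} (P : PMF (Fin (m + 1))) (J : Finset (Fin m)) :
    0 ≤ containProb P J :=
  Finset.sum_nonneg fun B _ => mul_nonneg (weight_nonneg P B) (by split_ifs <;> norm_num)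

lemma containProb_anti {m : ℕ} (P : PMF (Fin (m + 1))) {J K : Finset (Fin m)} (h : J ⊆ K) :
    containProb P K ≤ containProb P J := by
  refine Finset.sum_le_sum fun B _ => mul_le_mul_of_nonneg_left ?_ (weight_nonneg P B)
  by_cases hK : K ⊆ B
  · simp [hK, h.trans hK]
  · simp only [hK, if_false]
    split_ifs <;> norm_num

lemma containProb_eq {m : ℕ} (P : PMF (Fin (m + 1))) (J : Finset (Fin m)) :
    containProb P J =
      (∫ x : Fin (m + 1), ((x : ℕ).choose J.card : ℝ) ∂P.toMeasure) / (m.choose J.card : ℝ) := by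
  have hJ : J.card ≤ m := card_finset_fin_le J
  have hM : (m.choose J.card : ℝ) ≠ 0 := by exact_mod_cast (Nat.choose_pos hJ).ne'
  rw [PMF.integral_eq_sum, Finset.sum_div]
  simp only [smul_eq_mul, mul_div_assoc]
  refine sum_weight_mul_eq P _ _ fun x => ?_
  rw [← Finset.sum_filter, Finset.sum_const, nsmul_eq_mul, mul_one]
  by_cases hx : J.card ≤ (x : ℕ)
  · rw [Finset.card_filter_powersetCard_subset _ _ _ (Finset.subset_univ J) hx]
    rw [Finset.card_univ, Fintype.card_fin, mul_div_assoc', eq_div_iff hM]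
    have := Nat.choose_mul (n := m) hx
    have h2 : ((m.choose x * (x : ℕ).choose J.card : ℕ) : ℝ) =
      ((m.choose J.card * (m - J.card).choose (x - J.card) : ℕ) : ℝ) := by rw [this]
    push_cast at h2
    rw [h2]; ring
  · push Not at hx
    rw [Nat.choose_eq_zero_of_lt hx]
    simp only [Nat.cast_zero, zero_div, mul_zero, Nat.cast_eq_zero, Finset.card_eq_zero]
    refine Finset.filter_false_of_mem fun A hA hJA => ?_
    have := Finset.card_le_card hJA
    rw [(Finset.mem_powersetCard.mp hA).2] at this
    omega

/-- The probability `𝔼 (X choose j) / (m choose j)` that a random attribute set contains `j` given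
attributes. -/
def meanContain {m : ℕ} (P : PMF (Fin (m + 1))) (j : ℕ) : ℝ :=
  (∫ x : Fin (m + 1), ((x : ℕ).choose j : ℝ) ∂P.toMeasure) / (m.choose j : ℝ)

lemma meanContain_nonneg {m : ℕ} (P : PMF (Fin (m + 1))) (j : ℕ) : 0 ≤ meanContain P j :=
  div_nonneg (integral_nonneg fun _ => Nat.cast_nonneg _) (Nat.cast_nonneg _)

lemma containProb_of_card {m : ℕ} (P : PMF (Fin (m + 1))) {J : Finset (Fin m)} {j : ℕ}
    (h : J.card = j) : containProb P J = meanContain P j := by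
  rw [containProb_eq, h]; rfl

lemma containProb_le_of_le_card {m : ℕ} (P : PMF (Fin (m + 1))) {J : Finset (Fin m)} {j : ℕ}
    (h : j ≤ J.card) : containProb P J ≤ meanContain P j := by
  obtain ⟨K, hKJ, hK⟩ := Finset.exists_subset_card_eq h
  exact (containProb_anti P hKJ).trans (containProb_of_card P hK).le

/-- Two distinct `s`-subsets have at least `s + 1` elements in their union. -/
lemma containProb_union_le {m s : ℕ} (P : PMF (Fin (m + 1))) {S T : Finset (Fin m)}
    (hS : S.card = s) (hT : T.card = s) (hne : S ≠ T) :
    containProb P (S ∪ T) ≤ meanContain P (s + 1) := by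
  refine containProb_le_of_le_card P ?_
  rw [← hS]
  refine Finset.card_lt_card (Finset.ssubset_iff_subset_ne.mpr ⟨Finset.subset_union_left, ?_⟩)
  intro h
  have hTS : T ⊆ S := by rw [h]; exact Finset.subset_union_right
  exact hne (Finset.eq_of_subset_of_card_le hTS (by omega)).symm

lemma sub_le_choose {s : ℕ} (hs : 1 ≤ s) (x : ℕ) : x - s ≤ x.choose s := by
  obtain ⟨r, rfl⟩ : ∃ r, s = r + 1 := ⟨s - 1, by omega⟩
  induction x with
  | zero => simp
  | succ x ih =>
    rcases lt_or_ge x r with h | h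
    · simp [Nat.sub_eq_zero_of_le (by omega : x + 1 ≤ r + 1)]
    · have := Nat.choose_pos h
      rw [Nat.choose_succ_succ']
      omega

/-- Since `(x choose s) (x - s) ≤ (x choose s)²`, a second moment bound on the number of joints
controls the probability of containing one attribute more than a joint. -/
lemma meanContain_succ_le {m s : ℕ} (P : PMF (Fin (m + 1))) (hs : 1 ≤ s) (hsm : s < m) :
    meanContain P (s + 1) ≤
      (∫ x : Fin (m + 1), ((x : ℕ).choose s : ℝ) ^ 2 ∂P.toMeasure) /
        ((m.choose s : ℝ) * ((m : ℝ) - s)) := by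
  have hM : (0 : ℝ) < m.choose s := by exact_mod_cast Nat.choose_pos hsm.le
  have hms : (0 : ℝ) < (m : ℝ) - s := by
    have : (s : ℝ) < m := by exact_mod_cast hsm
    linarith
  have hM1 : (0 : ℝ) < m.choose (s + 1) := by exact_mod_cast Nat.choose_pos hsm
  have hid : (m.choose (s + 1) : ℝ) * (s + 1) = m.choose s * ((m : ℝ) - s) := by
    have := Nat.choose_succ_right_eq m s
    rw [← Nat.cast_sub hsm.le]
    exact_mod_cast this
  rw [meanContain, ← hid, div_le_div_iff₀ hM1 (by positivity)]
  have hpt : ∀ x : ℕ, (x.choose (s + 1) : ℝ) * (s + 1) ≤ (x.choose s : ℝ) ^ 2 := by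
    intro x
    have h1 := Nat.choose_succ_right_eq x s
    have h2 : x.choose s * (x - s) ≤ x.choose s * x.choose s := by
      rcases le_or_gt x s with h | h
      · simp [Nat.sub_eq_zero_of_le h]
      · refine Nat.mul_le_mul_left _ ?_
        exact sub_le_choose hs x
    rw [← h1] at h2
    rw [sq]
    exact_mod_cast h2
  have hint : (∫ x : Fin (m + 1), ((x : ℕ).choose (s + 1) : ℝ) ∂P.toMeasure) * ((s : ℝ) + 1) ≤
      ∫ x : Fin (m + 1), ((x : ℕ).choose s : ℝ) ^ 2 ∂P.toMeasure := by
    rw [← integral_mul_const]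
    exact integral_mono Integrable.of_finite Integrable.of_finite fun x => hpt x
  calc (∫ x : Fin (m + 1), ((x : ℕ).choose (s + 1) : ℝ) ∂P.toMeasure) *
        ((m.choose (s + 1) : ℝ) * (s + 1))
      = ((∫ x : Fin (m + 1), ((x : ℕ).choose (s + 1) : ℝ) ∂P.toMeasure) * ((s : ℝ) + 1)) *
        m.choose (s + 1) := by ring
    _ ≤ _ := mul_le_mul_of_nonneg_right hint hM1.le

/-! ### Bonferroni bounds for edges and triangles -/

section Bonferroni

variable {ι κ : Type*} [Fintype κ]

lemma weighted_union_le (w : κ → ℝ) (hw : ∀ x, 0 ≤ w x) (T : Finset ι) (E : ι → κ → Prop)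
    [∀ i, DecidablePred (E i)] (R : κ → Prop) [DecidablePred R]
    (hR : ∀ x, R x → ∃ i ∈ T, E i x) :
    ∑ x, (w x * if R x then 1 else 0) ≤ ∑ i ∈ T, ∑ x, w x * if E i x then 1 else 0 := by
  rw [Finset.sum_comm]
  refine Finset.sum_le_sum fun x _ => ?_
  rw [← Finset.mul_sum]
  refine mul_le_mul_of_nonneg_left ?_ (hw x)
  have hnn : ∀ i ∈ T, (0 : ℝ) ≤ if E i x then 1 else 0 := fun i _ => by split_ifs <;> norm_num
  by_cases hx : R x
  · obtain ⟨i, hi, hE⟩ := hR x hx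
    rw [if_pos hx]
    calc (1 : ℝ) = if E i x then 1 else 0 := by rw [if_pos hE]
      _ ≤ _ := Finset.single_le_sum hnn hi
  · rw [if_neg hx]
    exact Finset.sum_nonneg hnn

/-- The second Bonferroni inequality `ℙ(⋃ Eᵢ) ≥ ∑ᵢ ℙ(Eᵢ) - ∑_{i ≠ j} ℙ(Eᵢ ∩ Eⱼ)`, for events of
equal probability `p` with pairwise intersections of probability at most `r`. -/
lemma le_weighted_union (w : κ → ℝ) (hw : ∀ x, 0 ≤ w x) (T : Finset ι) (E : ι → κ → Prop)
    [∀ i, DecidablePred (E i)] (R : κ → Prop) [DecidablePred R]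
    (hR : ∀ x, ∀ i ∈ T, E i x → R x) {p r : ℝ} (hr : 0 ≤ r)
    (hp : ∀ i ∈ T, ∑ x, (w x * if E i x then 1 else 0) = p)
    (hpair : ∀ i ∈ T, ∀ j ∈ T, i ≠ j → ∑ x, (w x * if E i x ∧ E j x then 1 else 0) ≤ r) :
    (T.card : ℝ) * p - (T.card : ℝ) ^ 2 * r ≤ ∑ x, w x * if R x then 1 else 0 := by
  have h1 : ∑ x, w x * ∑ i ∈ T, (if E i x then (1 : ℝ) else 0) = T.card * p := by
    simp only [Finset.mul_sum]
    rw [Finset.sum_comm, Finset.sum_congr rfl hp, Finset.sum_const, nsmul_eq_mul]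
  have h2 : ∑ x, w x * ∑ ij ∈ T.offDiag, (if E ij.1 x ∧ E ij.2 x then (1 : ℝ) else 0)
      ≤ (T.card : ℝ) ^ 2 * r := by
    simp only [Finset.mul_sum]
    rw [Finset.sum_comm]
    calc _ ≤ ∑ ij ∈ T.offDiag, r := Finset.sum_le_sum fun ij hij => by
            rw [Finset.mem_offDiag] at hij
            exact hpair _ hij.1 _ hij.2.1 hij.2.2
      _ = (T.offDiag.card : ℝ) * r := by rw [Finset.sum_const, nsmul_eq_mul]
      _ ≤ _ := by
        refine mul_le_mul_of_nonneg_right ?_ hr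
        rw [Finset.offDiag_card, sq]
        exact_mod_cast Nat.sub_le _ _
  have h3 : ∀ x, w x * ∑ i ∈ T, (if E i x then (1 : ℝ) else 0) -
      w x * ∑ ij ∈ T.offDiag, (if E ij.1 x ∧ E ij.2 x then (1 : ℝ) else 0) ≤
      w x * if R x then 1 else 0 := by
    intro x
    rw [← mul_sub]
    refine mul_le_mul_of_nonneg_left ?_ (hw x)
    -- With `c` events holding at `x`, this is `c - c (c - 1) ≤ 1`.
    set U := T.filter (fun i => E i x) with hU
    have e1 : ∑ i ∈ T, (if E i x then (1 : ℝ) else 0) = U.card := by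
      rw [Finset.sum_boole]
    have e2 : ∑ ij ∈ T.offDiag, (if E ij.1 x ∧ E ij.2 x then (1 : ℝ) else 0) = U.offDiag.card := by
      rw [Finset.sum_boole]
      congr 2
      ext ⟨i, j⟩
      simp only [Finset.mem_filter, Finset.mem_offDiag, hU]
      tauto
    rw [e1, e2, Finset.offDiag_card, Nat.cast_sub (Nat.le_mul_self _), Nat.cast_mul]
    by_cases hx : R x
    · rw [if_pos hx]
      nlinarith [sq_nonneg ((U.card : ℝ) - 1)]
    · have : U = ∅ := Finset.filter_false_of_mem fun i hi hE => hx (hR x i hi hE)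
      rw [if_neg hx, this]
      simp
  calc (T.card : ℝ) * p - (T.card : ℝ) ^ 2 * r
      ≤ ∑ x, (w x * ∑ i ∈ T, (if E i x then (1 : ℝ) else 0) -
        w x * ∑ ij ∈ T.offDiag, (if E ij.1 x ∧ E ij.2 x then (1 : ℝ) else 0)) := by
        rw [Finset.sum_sub_distrib, h1]
        linarith
    _ ≤ _ := Finset.sum_le_sum fun x _ => h3 x

end Bonferroni

/-- The conditional probability of an edge `v ∼ v'`, given `D v = A`. -/
def edgeProb {m : ℕ} (P : PMF (Fin (m + 1))) (s : ℕ) (A : Finset (Fin m)) : ℝ :=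
  ∑ B, weight P B * if s ≤ (A ∩ B).card then 1 else 0

/-- The conditional probability of the triangle `v, v', v''`, given `D v = A`. -/
def triangleProb {m : ℕ} (P : PMF (Fin (m + 1))) (s : ℕ) (A : Finset (Fin m)) : ℝ :=
  ∑ x : Finset (Fin m) × Finset (Fin m), weight P x.1 * weight P x.2 *
    if s ≤ (A ∩ x.1).card ∧ s ≤ (A ∩ x.2).card ∧ s ≤ (x.1 ∩ x.2).card then 1 else 0

lemma edgeProb_nonneg {m : ℕ} (P : PMF (Fin (m + 1))) (s : ℕ) (A : Finset (Fin m)) :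
    0 ≤ edgeProb P s A :=
  Finset.sum_nonneg fun B _ => mul_nonneg (weight_nonneg P B) (by split_ifs <;> norm_num)

lemma edgeProb_le_one {m : ℕ} (P : PMF (Fin (m + 1))) (s : ℕ) (A : Finset (Fin m)) :
    edgeProb P s A ≤ 1 := by
  rw [← sum_weight P]
  refine Finset.sum_le_sum fun B _ => ?_
  have := weight_nonneg P B
  split_ifs <;> simp [this]

lemma triangleProb_nonneg {m : ℕ} (P : PMF (Fin (m + 1))) (s : ℕ) (A : Finset (Fin m)) :
    0 ≤ triangleProb P s A :=
  Finset.sum_nonneg fun x _ => mul_nonneg (mul_nonneg (weight_nonneg P _) (weight_nonneg P _))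
    (by split_ifs <;> norm_num)

/-- The sum over pairs of sets of a product event factorizes. -/
lemma sum_pair_indicator {m : ℕ} (P : PMF (Fin (m + 1))) (p q : Finset (Fin m) → Prop)
    [DecidablePred p] [DecidablePred q] :
    ∑ x : Finset (Fin m) × Finset (Fin m), (weight P x.1 * weight P x.2 *
      if p x.1 ∧ q x.2 then 1 else 0) =
      (∑ B, weight P B * if p B then 1 else 0) * ∑ C, weight P C * if q C then 1 else 0 := by
  rw [Finset.sum_mul_sum, Fintype.sum_prod_type]
  refine Finset.sum_congr rfl fun B _ => Finset.sum_congr rfl fun C _ => ?_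
  by_cases h1 : p B <;> by_cases h2 : q C <;> simp [h1, h2]

lemma triangleProb_le_sq {m : ℕ} (P : PMF (Fin (m + 1))) (s : ℕ) (A : Finset (Fin m)) :
    triangleProb P s A ≤ edgeProb P s A ^ 2 := by
  rw [sq, edgeProb, ← sum_pair_indicator P (fun B => s ≤ (A ∩ B).card) fun B => s ≤ (A ∩ B).card]
  refine Finset.sum_le_sum fun x _ => mul_le_mul_of_nonneg_left ?_
    (mul_nonneg (weight_nonneg P _) (weight_nonneg P _))
  split_ifs with h1 h2 <;> first | exact absurd ⟨h1.1, h1.2.1⟩ h2 | norm_num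

lemma le_card_inter_iff {m s : ℕ} (A B : Finset (Fin m)) :
    s ≤ (A ∩ B).card ↔ ∃ S ∈ A.powersetCard s, S ⊆ B := by
  constructor
  · intro h
    obtain ⟨S, hS, hc⟩ := Finset.exists_subset_card_eq h
    exact ⟨S, Finset.mem_powersetCard.mpr ⟨hS.trans Finset.inter_subset_left, hc⟩,
      hS.trans Finset.inter_subset_right⟩
  · rintro ⟨S, hS, hB⟩
    rw [Finset.mem_powersetCard] at hS
    rw [← hS.2]
    exact Finset.card_le_card (Finset.subset_inter hS.1 hB)

lemma edgeProb_le {m : ℕ} (P : PMF (Fin (m + 1))) (s : ℕ) (A : Finset (Fin m)) :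
    edgeProb P s A ≤ (A.card.choose s : ℝ) * meanContain P s := by
  calc edgeProb P s A ≤ ∑ S ∈ A.powersetCard s, containProb P S :=
        weighted_union_le (weight P) (weight_nonneg P) (A.powersetCard s) (fun S B => S ⊆ B)
          (fun B => s ≤ (A ∩ B).card) fun B hB => (le_card_inter_iff A B).mp hB
    _ = ∑ S ∈ A.powersetCard s, meanContain P s := Finset.sum_congr rfl fun S hS =>
        containProb_of_card P (Finset.mem_powersetCard.mp hS).2
    _ = _ := by rw [Finset.sum_const, Finset.card_powersetCard, nsmul_eq_mul]

lemma le_edgeProb {m : ℕ} (P : PMF (Fin (m + 1))) (s : ℕ) (A : Finset (Fin m)) :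
    (A.card.choose s : ℝ) * meanContain P s -
      (A.card.choose s : ℝ) ^ 2 * meanContain P (s + 1) ≤ edgeProb P s A := by
  have := le_weighted_union (weight P) (weight_nonneg P) (A.powersetCard s) (fun S B => S ⊆ B)
    (fun B => s ≤ (A ∩ B).card) (fun B S hS hB => (le_card_inter_iff A B).mpr ⟨S, hS, hB⟩)
    (p := meanContain P s) (r := meanContain P (s + 1)) (meanContain_nonneg P _)
    (fun S hS => containProb_of_card P (Finset.mem_powersetCard.mp hS).2)
    (fun S hS T hT hne => by
      simp only [← Finset.union_subset_iff]
      exact containProb_union_le P (Finset.mem_powersetCard.mp hS).2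
        (Finset.mem_powersetCard.mp hT).2 hne)
  rwa [Finset.card_powersetCard] at this

/-- The main contribution to a triangle comes from a joint common to all three sets. -/
lemma le_triangleProb {m : ℕ} (P : PMF (Fin (m + 1))) (s : ℕ) (A : Finset (Fin m)) :
    (A.card.choose s : ℝ) * meanContain P s ^ 2 -
      (A.card.choose s : ℝ) ^ 2 * meanContain P (s + 1) ^ 2 ≤ triangleProb P s A := by
  have := le_weighted_union
    (fun x : Finset (Fin m) × Finset (Fin m) => weight P x.1 * weight P x.2)
    (fun x => mul_nonneg (weight_nonneg P _) (weight_nonneg P _))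
    (A.powersetCard s) (fun S x => S ⊆ x.1 ∧ S ⊆ x.2)
    (fun x => s ≤ (A ∩ x.1).card ∧ s ≤ (A ∩ x.2).card ∧ s ≤ (x.1 ∩ x.2).card)
    (fun x S hS hB => ⟨(le_card_inter_iff A _).mpr ⟨S, hS, hB.1⟩,
      (le_card_inter_iff A _).mpr ⟨S, hS, hB.2⟩, by
        rw [← (Finset.mem_powersetCard.mp hS).2]
        exact Finset.card_le_card (Finset.subset_inter hB.1 hB.2)⟩)
    (p := meanContain P s ^ 2) (r := meanContain P (s + 1) ^ 2) (sq_nonneg _)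
    (fun S hS => by
      rw [sum_pair_indicator P (fun B => S ⊆ B) (fun B => S ⊆ B), sq,
        ← containProb_of_card P (Finset.mem_powersetCard.mp hS).2]
      rfl)
    (fun S hS T hT hne => by
      have h := containProb_union_le P (Finset.mem_powersetCard.mp hS).2
        (Finset.mem_powersetCard.mp hT).2 hne
      have e : ∀ x : Finset (Fin m) × Finset (Fin m),
          ((S ⊆ x.1 ∧ S ⊆ x.2) ∧ T ⊆ x.1 ∧ T ⊆ x.2) ↔ (S ∪ T ⊆ x.1 ∧ S ∪ T ⊆ x.2) := by
        intro x
        rw [Finset.union_subset_iff, Finset.union_subset_iff]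
        tauto
      simp only [e]
      rw [sum_pair_indicator P (fun B => S ∪ T ⊆ B) (fun B => S ∪ T ⊆ B), ← sq]
      exact pow_le_pow_left₀ (containProb_nonneg P _) h 2)
  rwa [Finset.card_powersetCard] at this

/-- A triangle without a joint common to all three sets needs an attribute outside `A` shared by
the two other sets, each of which also contains a joint of `A`. -/
lemma triangleProb_le {m : ℕ} (P : PMF (Fin (m + 1))) (s : ℕ) (A : Finset (Fin m)) :
    triangleProb P s A ≤ (A.card.choose s : ℝ) * meanContain P s ^ 2 +
      (A.card.choose s : ℝ) ^ 2 * m * meanContain P (s + 1) ^ 2 := by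
  set W : Finset (Fin m) × Finset (Fin m) → ℝ := fun x => weight P x.1 * weight P x.2 with hW
  have hWn : ∀ x, 0 ≤ W x := fun x => mul_nonneg (weight_nonneg P _) (weight_nonneg P _)
  let R1 : Finset (Fin m) × Finset (Fin m) → Prop :=
    fun x => ∃ S ∈ A.powersetCard s, S ⊆ x.1 ∧ S ⊆ x.2
  let R2 : Finset (Fin m) × Finset (Fin m) → Prop :=
    fun x => ∃ y ∈ (A.powersetCard s ×ˢ A.powersetCard s) ×ˢ Aᶜ,
      insert y.2 y.1.1 ⊆ x.1 ∧ insert y.2 y.1.2 ⊆ x.2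
  have h1 : ∑ x, (W x * if R1 x then 1 else 0) ≤
      (A.card.choose s : ℝ) * meanContain P s ^ 2 := by
    refine (weighted_union_le W hWn (A.powersetCard s) (fun S x => S ⊆ x.1 ∧ S ⊆ x.2) R1
      fun x hx => hx).trans ?_
    rw [← Finset.card_powersetCard, ← nsmul_eq_mul]
    refine Finset.sum_le_card_nsmul _ _ _ fun S hS => ?_
    simp only [hW]
    rw [sum_pair_indicator P (fun B => S ⊆ B) (fun B => S ⊆ B), sq,
        ← containProb_of_card P (Finset.mem_powersetCard.mp hS).2]
    rfl
  have h2 : ∑ x, (W x * if R2 x then 1 else 0) ≤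
      (A.card.choose s : ℝ) ^ 2 * m * meanContain P (s + 1) ^ 2 := by
    refine (weighted_union_le W hWn ((A.powersetCard s ×ˢ A.powersetCard s) ×ˢ Aᶜ)
      (fun y x => insert y.2 y.1.1 ⊆ x.1 ∧ insert y.2 y.1.2 ⊆ x.2) R2 fun x hx => hx).trans ?_
    have hcard : (((A.powersetCard s ×ˢ A.powersetCard s) ×ˢ Aᶜ).card : ℝ) ≤
        (A.card.choose s : ℝ) ^ 2 * m := by
      rw [Finset.card_product, Finset.card_product, Finset.card_powersetCard, sq]
      push_cast
      refine mul_le_mul_of_nonneg_left ?_ (by positivity)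
      exact_mod_cast card_finset_fin_le _
    refine le_trans ?_ (mul_le_mul_of_nonneg_right hcard (sq_nonneg _))
    rw [← nsmul_eq_mul]
    refine Finset.sum_le_card_nsmul _ _ _ fun y hy => ?_
    simp only [Finset.mem_product, Finset.mem_powersetCard, Finset.mem_compl] at hy
    simp only [hW]
    rw [sum_pair_indicator P (fun B => insert y.2 y.1.1 ⊆ B) (fun B => insert y.2 y.1.2 ⊆ B), sq]
    refine mul_le_mul (containProb_of_card P ?_).le (containProb_of_card P ?_).le
      (containProb_nonneg P _) (meanContain_nonneg P _)
    · rw [Finset.card_insert_of_notMem fun h => hy.2 (hy.1.1.1 h), hy.1.1.2]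
    · rw [Finset.card_insert_of_notMem fun h => hy.2 (hy.1.2.1 h), hy.1.2.2]
  refine le_trans ?_ (add_le_add h1 h2)
  rw [← Finset.sum_add_distrib]
  refine Finset.sum_le_sum fun x _ => ?_
  rw [← mul_add]
  refine mul_le_mul_of_nonneg_left ?_ (hWn x)
  have hnn : ∀ (p : Prop) [Decidable p], (0 : ℝ) ≤ if p then 1 else 0 := fun p _ => by
    split_ifs <;> norm_num
  split_ifs with h h3 h4 h4 <;> try norm_num
  obtain ⟨hA1, hA2, h12⟩ := h
  obtain ⟨S, hS, hS1⟩ := (le_card_inter_iff _ _).mp hA1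
  obtain ⟨T, hT, hT2⟩ := (le_card_inter_iff _ _).mp hA2
  obtain ⟨U, hU, hU2⟩ := (le_card_inter_iff _ _).mp h12
  rw [Finset.mem_powersetCard] at hU
  by_cases hUA : U ⊆ A
  · exact h3 ⟨U, Finset.mem_powersetCard.mpr ⟨hUA, hU.2⟩, hU.1, hU2⟩
  · obtain ⟨a, haU, haA⟩ := Finset.not_subset.mp hUA
    refine h4 ⟨((S, T), a), ?_, ?_, ?_⟩
    · simp [Finset.mem_powersetCard.mp hS, Finset.mem_powersetCard.mp hT, haA]
    · exact Finset.insert_subset (hU.1 haU) hS1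
    · exact Finset.insert_subset (hU2 haU) hT2

/-! ### The law of the neighbourhood of a vertex -/

instance (n m : ℕ) (P : PMF (Fin (m + 1))) : IsProbabilityMeasure (setsLaw n m P) := by
  unfold setsLaw; infer_instance

lemma attributeLaw_real {m : ℕ} (P : PMF (Fin (m + 1))) (p : Finset (Fin m) → Prop)
    [DecidablePred p] :
    (attributeLaw m P).toMeasure.real {B | p B} = ∑ B, weight P B * if p B then 1 else 0 := by
  rw [Measure.real, PMF.toMeasure_apply_fintype, ENNReal.toReal_sum]
  · refine Finset.sum_congr rfl fun B _ => ?_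
    by_cases h : p B <;> simp [h, weight]
  · intro B _
    by_cases h : p B <;> simp [h, PMF.apply_ne_top]

lemma attributeLaw_real_singleton {m : ℕ} (P : PMF (Fin (m + 1))) (A : Finset (Fin m)) :
    (attributeLaw m P).toMeasure.real {A} = weight P A := by
  rw [Measure.real, PMF.toMeasure_apply_singleton _ _ (measurableSet_singleton A), weight]

/-- The event that `D v = A`, `D v' = B`, `D v'' = C` and that, among the remaining vertices,
exactly those in `N` are adjacent to `v`. It is a product set. -/
def starBox {n m : ℕ} (s : ℕ) (v v' v'' : Fin n) (A B C : Finset (Fin m)) (N : Finset (Fin n)) :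
    Set (Fin n → Finset (Fin m)) :=
  Set.univ.pi fun i => if i = v then {A} else if i = v' then {B} else if i = v'' then {C} else
    {D | i ∈ N ↔ s ≤ (A ∩ D).card}

lemma mem_starBox {n m : ℕ} {s : ℕ} {v v' v'' : Fin n} (h1 : v ≠ v') (h2 : v ≠ v'')
    (h3 : v' ≠ v'') {A B C : Finset (Fin m)} {N : Finset (Fin n)}
    {D : Fin n → Finset (Fin m)} :
    D ∈ starBox s v v' v'' A B C N ↔ D v = A ∧ D v' = B ∧ D v'' = C ∧
      ∀ i ∈ ({v, v', v''} : Finset (Fin n))ᶜ, (i ∈ N ↔ s ≤ (A ∩ D i).card) := by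
  simp only [starBox, Set.mem_univ_pi]
  constructor
  · intro h
    refine ⟨by simpa using h v, by simpa [h1.symm] using h v',
      by simpa [h2.symm, h3.symm] using h v'', fun i hi => ?_⟩
    simp only [Finset.mem_compl, Finset.mem_insert, Finset.mem_singleton, not_or] at hi
    simpa [hi.1, hi.2.1, hi.2.2] using h i
  · rintro ⟨hA, hB, hC, hN⟩ i
    split_ifs with e1 e2 e3
    · simp [e1, hA]
    · simp [e2, hB]
    · simp [e3, hC]
    · exact hN i (by simp [e1, e2, e3])

lemma setsLaw_starBox {n m : ℕ} (P : PMF (Fin (m + 1))) (s : ℕ) {v v' v'' : Fin n} (h1 : v ≠ v')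
    (h2 : v ≠ v'') (h3 : v' ≠ v'') (A B C : Finset (Fin m)) {N : Finset (Fin n)}
    (hN : N ⊆ ({v, v', v''} : Finset (Fin n))ᶜ) :
    (setsLaw n m P).real (starBox s v v' v'' A B C N) =
      weight P A * (weight P B * weight P C) *
        (edgeProb P s A ^ N.card * (1 - edgeProb P s A) ^ (n - 3 - N.card)) := by
  have hq : (attributeLaw m P).toMeasure.real {D | s ≤ (A ∩ D).card} = edgeProb P s A :=
    attributeLaw_real P _
  have hq' : (attributeLaw m P).toMeasure.real {D | ¬ s ≤ (A ∩ D).card} = 1 - edgeProb P s A := by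
    rw [← hq]
    exact probReal_compl_eq_one_sub (μ := (attributeLaw m P).toMeasure)
      (s := {D | s ≤ (A ∩ D).card}) (Set.toFinite _).measurableSet
  rw [Measure.real, setsLaw, starBox, Measure.pi_pi, ENNReal.toReal_prod,
    ← Finset.prod_mul_prod_compl {v, v', v''}]
  congr 1
  · rw [Finset.prod_insert (by simp [h1, h2]), Finset.prod_insert (by simp [h3]),
      Finset.prod_singleton]
    simp only [h1.symm, h2.symm, h3.symm, if_true, if_false]
    simp only [← measureReal_def, attributeLaw_real_singleton]
  · have hcard : ({v, v', v''} : Finset (Fin n))ᶜ.card = n - 3 := by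
      rw [Finset.card_compl, Fintype.card_fin, Finset.card_eq_three.mpr ⟨v, v', v'', h1, h2, h3, rfl⟩]
    rw [Finset.prod_congr rfl (g := fun i => if i ∈ N then edgeProb P s A else 1 - edgeProb P s A),
      Finset.prod_ite, Finset.prod_const, Finset.prod_const]
    · have e1 : Finset.filter (fun i => i ∈ N) ({v, v', v''} : Finset (Fin n))ᶜ = N := by
        ext i
        simp only [Finset.mem_filter]
        exact ⟨fun h => h.2, fun h => ⟨hN h, h⟩⟩
      have e2 : Finset.filter (fun i => i ∉ N) ({v, v', v''} : Finset (Fin n))ᶜ =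
          ({v, v', v''} : Finset (Fin n))ᶜ \ N := by
        ext i
        simp only [Finset.mem_filter, Finset.mem_sdiff]
      rw [e1, e2, Finset.card_sdiff_of_subset hN, hcard]
    · intro i hi
      simp only [Finset.mem_compl, Finset.mem_insert, Finset.mem_singleton, not_or] at hi
      simp only [hi.1, hi.2.1, hi.2.2, if_false]
      rw [← Measure.real]
      by_cases hi' : i ∈ N
      · simp only [hi', true_iff, if_true, hq]
      · simp only [hi', false_iff, if_false, hq']

/-- The vertices outside `{v, v', v''}` that are adjacent to `v`. -/
def otherNeighbors {n m : ℕ} (s : ℕ) (D : Fin n → Finset (Fin m)) (v v' v'' : Fin n) :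
    Finset (Fin n) :=
  ({v, v', v''} : Finset (Fin n))ᶜ.filter fun i => s ≤ (D v ∩ D i).card

lemma degree_eq {n m : ℕ} {s : ℕ} {D : Fin n → Finset (Fin m)} {v v' v'' : Fin n}
    (h3 : v' ≠ v'') (h : (graph s D).Adj v v') (h' : (graph s D).Adj v v'') :
    (graph s D).degree v = (otherNeighbors s D v v' v'').card + 2 := by
  have e : (graph s D).neighborFinset v =
      insert v' (insert v'' (otherNeighbors s D v v' v'')) := by
    ext i
    simp only [SimpleGraph.mem_neighborFinset, Finset.mem_insert, otherNeighbors,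
      Finset.mem_filter, Finset.mem_compl, Finset.mem_singleton, not_or]
    constructor
    · intro hi
      by_cases e1 : i = v'
      · exact Or.inl e1
      · by_cases e2 : i = v''
        · exact Or.inr (Or.inl e2)
        · exact Or.inr (Or.inr ⟨⟨hi.1.symm, e1, e2⟩, hi.2⟩)
    · rintro (rfl | rfl | hi)
      · exact h
      · exact h'
      · exact ⟨fun e => hi.1.1 e.symm, hi.2⟩
  rw [← SimpleGraph.card_neighborFinset_eq_degree, e, Finset.card_insert_of_notMem,
    Finset.card_insert_of_notMem]
  · simp [otherNeighbors]
  · simp [otherNeighbors, h3]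

/-- The joint probability of the cherry event and of a further property `R` of the three attribute
sets: given `D v = A`, the remaining `n - 3` vertices are adjacent to `v` independently and with
probability `edgeProb P s A`. -/
lemma setsLaw_cherry {n m : ℕ} (P : PMF (Fin (m + 1))) (s : ℕ) {k : ℕ} (hk : 2 ≤ k)
    {v v' v'' : Fin n} (h1 : v ≠ v') (h2 : v ≠ v'') (h3 : v' ≠ v'')
    (R : Finset (Fin m) → Finset (Fin m) → Prop) [∀ B C, Decidable (R B C)] :
    (setsLaw n m P).real (cherryEvent s k v v' v'' ∩ {D | R (D v') (D v'')}) =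
      ((n - 3).choose (k - 2) : ℝ) * ∑ A, weight P A *
        ((∑ x : Finset (Fin m) × Finset (Fin m), weight P x.1 * weight P x.2 *
          if s ≤ (A ∩ x.1).card ∧ s ≤ (A ∩ x.2).card ∧ R x.1 x.2 then 1 else 0) *
        (edgeProb P s A ^ (k - 2) * (1 - edgeProb P s A) ^ (n - 3 - (k - 2)))) := by
  set I : Finset ((Finset (Fin m) × Finset (Fin m) × Finset (Fin m)) × Finset (Fin n)) :=
    (Finset.univ.filter fun a : Finset (Fin m) × Finset (Fin m) × Finset (Fin m) =>
      s ≤ (a.1 ∩ a.2.1).card ∧ s ≤ (a.1 ∩ a.2.2).card ∧ R a.2.1 a.2.2) ×ˢ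
    Finset.powersetCard (k - 2) ({v, v', v''} : Finset (Fin n))ᶜ with hI
  have hset : cherryEvent s k v v' v'' ∩ {D | R (D v') (D v'')} =
      ⋃ y ∈ I, starBox s v v' v'' y.1.1 y.1.2.1 y.1.2.2 y.2 := by
    ext D
    simp only [Set.mem_inter_iff, cherryEvent, Set.mem_ofPred_eq, Set.mem_iUnion, exists_prop,
      mem_starBox h1 h2 h3]
    constructor
    · rintro ⟨⟨ha, hb, hd⟩, hR⟩
      refine ⟨((D v, D v', D v''), otherNeighbors s D v v' v''), ?_, rfl, rfl, rfl, ?_⟩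
      · simp only [hI, Finset.mem_product, Finset.mem_filter, Finset.mem_univ, true_and,
          Finset.mem_powersetCard]
        refine ⟨⟨ha.2, hb.2, hR⟩, Finset.filter_subset _ _, ?_⟩
        rw [degree_eq h3 ha hb] at hd
        omega
      · intro i hi
        simp only [otherNeighbors, Finset.mem_filter, hi, true_and]
    · rintro ⟨⟨⟨A, B, C⟩, N⟩, hy, rfl, rfl, rfl, hN⟩
      simp only [hI, Finset.mem_product, Finset.mem_filter, Finset.mem_univ, true_and,
          Finset.mem_powersetCard] at hy
      obtain ⟨⟨ha, hb, hR⟩, hsub, hc⟩ := hy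
      have e : otherNeighbors s D v v' v'' = N := by
        ext i
        simp only [otherNeighbors, Finset.mem_filter]
        exact ⟨fun h => (hN i h.1).mpr h.2, fun h => ⟨hsub h, (hN i (hsub h)).mp h⟩⟩
      refine ⟨⟨⟨h1, ha⟩, ⟨h2, hb⟩, ?_⟩, hR⟩
      rw [degree_eq h3 ⟨h1, ha⟩ ⟨h2, hb⟩, e, hc]
      omega
  have hdisj : (I : Set ((Finset (Fin m) × Finset (Fin m) × Finset (Fin m)) × Finset (Fin n))).PairwiseDisjoint
      fun y => starBox s v v' v'' y.1.1 y.1.2.1 y.1.2.2 y.2 := by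
    rintro ⟨⟨A, B, C⟩, N⟩ hy ⟨⟨A', B', C'⟩, N'⟩ hy' hne
    refine Set.disjoint_left.mpr fun D hD hD' => hne ?_
    simp only [mem_starBox h1 h2 h3] at hD hD'
    obtain ⟨rfl, rfl, rfl, hN⟩ := hD
    obtain ⟨rfl, rfl, rfl, hN'⟩ := hD'
    simp only [hI, Finset.coe_product, Set.mem_prod, Finset.mem_coe, Finset.mem_powersetCard]
      at hy hy'
    have : N = N' := by
      ext i
      constructor
      · intro h
        exact (hN' i (hy.2.1 h)).mpr ((hN i (hy.2.1 h)).mp h)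
      · intro h
        exact (hN i (hy'.2.1 h)).mpr ((hN' i (hy'.2.1 h)).mp h)
    rw [this]
  have hcard : ({v, v', v''} : Finset (Fin n))ᶜ.card = n - 3 := by
    rw [Finset.card_compl, Fintype.card_fin,
      Finset.card_eq_three.mpr ⟨v, v', v'', h1, h2, h3, rfl⟩]
  rw [hset, measureReal_biUnion_finset hdisj fun y _ => (Set.toFinite _).measurableSet, hI,
    Finset.sum_product]
  have hstep : ∀ a : Finset (Fin m) × Finset (Fin m) × Finset (Fin m),
      ∑ N ∈ Finset.powersetCard (k - 2) ({v, v', v''} : Finset (Fin n))ᶜ,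
        (setsLaw n m P).real (starBox s v v' v'' a.1 a.2.1 a.2.2 N) =
      ((n - 3).choose (k - 2) : ℝ) * (weight P a.1 * (weight P a.2.1 * weight P a.2.2) *
        (edgeProb P s a.1 ^ (k - 2) * (1 - edgeProb P s a.1) ^ (n - 3 - (k - 2)))) := by
    intro a
    rw [← hcard, ← Finset.card_powersetCard, ← nsmul_eq_mul, hcard]
    refine Finset.sum_eq_card_nsmul fun N hN => ?_
    rw [Finset.mem_powersetCard] at hN
    rw [setsLaw_starBox P s h1 h2 h3 _ _ _ hN.1, hN.2]
  rw [Finset.sum_congr rfl fun a _ => hstep a, ← Finset.mul_sum, Finset.sum_filter,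
    Fintype.sum_prod_type]
  congr 1
  refine Finset.sum_congr rfl fun A _ => ?_
  rw [Finset.sum_mul, Finset.mul_sum]
  refine Finset.sum_congr rfl fun x _ => ?_
  split_ifs <;> ring

/-! ### Poisson limits of binomial weights -/

/-- The Poisson limit of the probability that no edge is present, with a varying number of
trials: `exp (-q / (1 - q)) ≤ 1 - q ≤ exp (-q)`. -/
lemma tendsto_one_sub_pow {ι : Type*} {l : Filter ι} {q : ι → ℝ} {n : ι → ℕ} {t : ℝ}
    (hn : Tendsto n l atTop) (h : Tendsto (fun i => (n i : ℝ) * q i) l (𝓝 t)) (j : ℕ) :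
    Tendsto (fun i => (1 - q i) ^ (n i - j)) l (𝓝 (Real.exp (-t))) := by
  have hnR : Tendsto (fun i => (n i : ℝ)) l atTop := tendsto_natCast_atTop_atTop.comp hn
  have hq0 : Tendsto q l (𝓝 0) := by
    have h1 : Tendsto (fun i => (n i : ℝ) * q i * (n i : ℝ)⁻¹) l (𝓝 (t * 0)) :=
      h.mul (tendsto_inv_atTop_zero.comp hnR)
    rw [mul_zero] at h1
    refine h1.congr' ?_
    filter_upwards [hn.eventually_ge_atTop 1] with i hi
    have : (n i : ℝ) ≠ 0 := by exact_mod_cast (by omega : n i ≠ 0)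
    field_simp
  have hN : Tendsto (fun i => ((n i - j : ℕ) : ℝ) * q i) l (𝓝 t) := by
    have h1 : Tendsto (fun i => (n i : ℝ) * q i - j * q i) l (𝓝 (t - j * 0)) :=
      h.sub (hq0.const_mul _)
    rw [mul_zero, sub_zero] at h1
    refine h1.congr' ?_
    filter_upwards [hn.eventually_ge_atTop j] with i hi
    rw [Nat.cast_sub hi]
    ring
  have hlt : ∀ᶠ i in l, q i < 1 := hq0.eventually_lt_const one_pos
  have hup : Tendsto (fun i => Real.exp (-(((n i - j : ℕ) : ℝ) * q i))) l
      (𝓝 (Real.exp (-t))) := (Real.continuous_exp.tendsto _).comp hN.neg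
  have hlo : Tendsto (fun i => Real.exp (-(((n i - j : ℕ) : ℝ) * q i / (1 - q i)))) l
      (𝓝 (Real.exp (-t))) := by
    have h1 := hN.div (hq0.const_sub 1) (by norm_num)
    rw [sub_zero, div_one] at h1
    exact (Real.continuous_exp.tendsto _).comp h1.neg
  refine tendsto_of_tendsto_of_tendsto_of_le_of_le' hlo hup ?_ ?_
  · filter_upwards [hlt] with i hi
    have hpos : 0 < 1 - q i := by linarith
    have h1 : Real.exp (-(q i / (1 - q i))) ≤ 1 - q i := by
      rw [Real.exp_neg]
      refine inv_le_of_inv_le₀ hpos ?_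
      have h2 := Real.add_one_le_exp (q i / (1 - q i))
      have h3 : q i / (1 - q i) + 1 = (1 - q i)⁻¹ := by field_simp; ring
      rwa [h3] at h2
    calc Real.exp (-(((n i - j : ℕ) : ℝ) * q i / (1 - q i)))
        = Real.exp (-(q i / (1 - q i))) ^ (n i - j) := by
          rw [← Real.exp_nat_mul]; congr 1; ring
      _ ≤ _ := pow_le_pow_left₀ (Real.exp_nonneg _) h1 _
  · filter_upwards [hlt] with i hi
    calc (1 - q i) ^ (n i - j) ≤ Real.exp (-q i) ^ (n i - j) :=
          pow_le_pow_left₀ (by linarith) (Real.one_sub_le_exp_neg _) _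
      _ = _ := by rw [← Real.exp_nat_mul]; congr 1; ring

lemma tendsto_choose_sub_div_pow {ι : Type*} {l : Filter ι} {n : ι → ℕ}
    (hn : Tendsto n l atTop) (a j : ℕ) :
    Tendsto (fun i => ((n i - a).choose j : ℝ) / (n i : ℝ) ^ j) l (𝓝 (j.factorial : ℝ)⁻¹) := by
  have hcomp : Tendsto (fun N : ℕ => ((N - a).choose j : ℝ) / (N : ℝ) ^ j) atTop
      (𝓝 (j.factorial : ℝ)⁻¹) := by
    rw [← tendsto_add_atTop_iff_nat a]
    simp only [Nat.add_sub_cancel]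
    have h1 : Tendsto (fun N : ℕ => (N.choose j : ℝ) / ((N : ℝ) ^ j / j.factorial)) atTop
        (𝓝 1) := by
      refine (Asymptotics.isEquivalent_iff_tendsto_one ?_).mp (isEquivalent_choose j)
      filter_upwards [eventually_gt_atTop 0] with N hN
      have : (0 : ℝ) < N := by exact_mod_cast hN
      positivity
    have h2 : Tendsto (fun N : ℕ => (N : ℝ) / ((N : ℝ) + a)) atTop (𝓝 1) :=
      tendsto_natCast_div_add_atTop _
    have h3 := (h1.mul (h2.pow j)).mul_const (j.factorial : ℝ)⁻¹
    rw [one_pow, one_mul, one_mul] at h3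
    refine h3.congr' ?_
    filter_upwards [eventually_gt_atTop 0] with N hN
    have h0 : (0 : ℝ) < N := by exact_mod_cast hN
    have h0' : (0 : ℝ) < (N : ℝ) + a := by positivity
    have hf : (j.factorial : ℝ) ≠ 0 := by positivity
    push_cast
    rw [div_pow]
    field_simp
  exact hcomp.comp hn

/-- A bound, uniform in `q`, for the binomial weights of the cherry event. -/
lemma binomial_weight_le {n k : ℕ} (hk : 2 ≤ k) (hn : 2 * k + 2 ≤ n) {q : ℝ} (h0 : 0 ≤ q)
    (h1 : q ≤ 1) :
    (n : ℝ) ^ 2 * ((n - 3).choose (k - 2) * (q ^ 2 * (q ^ (k - 2) *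
      (1 - q) ^ (n - 3 - (k - 2))))) ≤ 2 ^ k * k.factorial := by
  have hc : ((n - 3).choose (k - 2) : ℝ) ≤ (n : ℝ) ^ (k - 2) := by
    have : (n - 3).choose (k - 2) ≤ n ^ (k - 2) :=
      (Nat.choose_le_pow _ _).trans (Nat.pow_le_pow_left (by omega) _)
    exact_mod_cast this
  have hN : (n : ℝ) / 2 ≤ ((n - 3 - (k - 2) : ℕ) : ℝ) := by
    rw [div_le_iff₀ two_pos]
    exact_mod_cast (by omega : n ≤ (n - 3 - (k - 2)) * 2)
  have hpow : (1 - q) ^ (n - 3 - (k - 2)) ≤ Real.exp (-(n * q / 2)) := by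
    calc (1 - q) ^ (n - 3 - (k - 2)) ≤ Real.exp (-q) ^ (n - 3 - (k - 2)) :=
          pow_le_pow_left₀ (by linarith) (Real.one_sub_le_exp_neg _) _
      _ = Real.exp (-(((n - 3 - (k - 2) : ℕ) : ℝ) * q)) := by
          rw [← Real.exp_nat_mul]; congr 1; ring
      _ ≤ _ := Real.exp_le_exp.mpr (by nlinarith)
  have hnq : 0 ≤ (n : ℝ) * q / 2 := by positivity
  have hexp := Real.pow_div_factorial_le_exp _ hnq k
  rw [div_le_iff₀ (by positivity)] at hexp
  have h1q : 0 ≤ 1 - q := by linarith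
  obtain ⟨j, rfl⟩ : ∃ j, k = j + 2 := ⟨k - 2, by omega⟩
  simp only [Nat.add_sub_cancel] at *
  calc (n : ℝ) ^ 2 * ((n - 3).choose j * (q ^ 2 * (q ^ j * (1 - q) ^ (n - 3 - j))))
      ≤ (n : ℝ) ^ 2 * ((n : ℝ) ^ j * (q ^ 2 * (q ^ j * Real.exp (-(n * q / 2))))) := by
        gcongr
    _ = 2 ^ (j + 2) * ((n * q / 2) ^ (j + 2) * Real.exp (-(n * q / 2))) := by
        rw [div_pow, mul_pow]; field_simp; ring
    _ ≤ 2 ^ (j + 2) * ((Real.exp (n * q / 2) * (j + 2).factorial) * Real.exp (-(n * q / 2))) := by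
        gcongr
    _ = _ := by
        rw [mul_right_comm, ← Real.exp_add, add_neg_cancel, Real.exp_zero, one_mul]

/-! ### Convergence in distribution and moments -/

section Distribution

open scoped BoundedContinuousFunction

lemma tendsto_integral_of_tendstoInDistribution {Ω : Type*} [MeasurableSpace Ω] {Pr : Measure Ω}
    [IsProbabilityMeasure Pr] {Z : Ω → ℝ} {ι : Type*} {Ω' : ι → Type*}
    [∀ i, MeasurableSpace (Ω' i)] {ν : ∀ i, Measure (Ω' i)} [∀ i, IsProbabilityMeasure (ν i)]
    {X : ∀ i, Ω' i → ℝ} {l : Filter ι} (h : TendstoInDistribution X l Z ν Pr) (g : ℝ →ᵇ ℝ) :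
    Tendsto (fun i => ∫ x, g (X i x) ∂ν i) l (𝓝 (∫ ω, g (Z ω) ∂Pr)) := by
  have h1 := (ProbabilityMeasure.tendsto_iff_forall_integral_tendsto.mp h.tendsto) g
  have e1 : ∀ i, ∫ x, g x ∂((ν i).map (X i)) = ∫ x, g (X i x) ∂ν i := fun i =>
    integral_map (h.forall_aemeasurable i) g.continuous.aestronglyMeasurable
  have e2 : ∫ x, g x ∂(Pr.map Z) = ∫ ω, g (Z ω) ∂Pr :=
    integral_map h.aemeasurable_limit g.continuous.aestronglyMeasurable
  simpa only [ProbabilityMeasure.coe_mk, e1, e2] using h1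

/-- A limit in distribution of nonnegative random variables is almost surely nonnegative. -/
lemma ae_nonneg_of_tendstoInDistribution {Ω : Type*} [MeasurableSpace Ω] {Pr : Measure Ω}
    [IsProbabilityMeasure Pr] {Z : Ω → ℝ} {ι : Type*} {Ω' : ι → Type*}
    [∀ i, MeasurableSpace (Ω' i)] {ν : ∀ i, Measure (Ω' i)} [∀ i, IsProbabilityMeasure (ν i)]
    {X : ∀ i, Ω' i → ℝ} {l : Filter ι} [l.NeBot] (h : TendstoInDistribution X l Z ν Pr)
    (hX : ∀ i x, 0 ≤ X i x) : ∀ᵐ ω ∂Pr, 0 ≤ Z ω := by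
  let g : ℝ →ᵇ ℝ := BoundedContinuousFunction.ofNormedAddCommGroup
    (fun z => min (max (-z) 0) 1) (by fun_prop) 1 (fun z => by
      rw [Real.norm_of_nonneg (le_min (le_max_right _ _) zero_le_one)]
      exact min_le_right _ _)
  have hg : ∀ z, g z = min (max (-z) 0) 1 := fun z => rfl
  have h1 := tendsto_integral_of_tendstoInDistribution h g
  have h2 : ∀ i, ∫ x, g (X i x) ∂ν i = 0 := fun i => by
    have : ∀ x, g (X i x) = 0 := fun x => by
      rw [hg, max_eq_right (by linarith [hX i x]), min_eq_left zero_le_one]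
    simp [this]
  simp only [h2] at h1
  have h3 := tendsto_nhds_unique h1 tendsto_const_nhds
  have hint : Integrable (fun ω => g (Z ω)) Pr :=
    Integrable.of_bound
      (g.continuous.measurable.comp_aemeasurable h.aemeasurable_limit).aestronglyMeasurable ‖g‖
      (Eventually.of_forall fun ω => g.norm_coe_le_norm _)
  have hnn : ∀ z, 0 ≤ g z := fun z => le_min (le_max_right _ _) zero_le_one
  rw [integral_eq_zero_iff_of_nonneg (fun ω => hnn _) hint] at h3
  filter_upwards [h3] with ω hω
  by_contra hneg
  push Not at hneg
  have h4 : 0 < g (Z ω) := by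
    rw [hg]; exact lt_min (lt_max_of_lt_left (by linarith)) one_pos
  exact h4.ne' hω

/-- The error in truncating a first moment is controlled by the second moment. -/
lemma abs_integral_sub_truncation_le {Ω : Type*} [MeasurableSpace Ω] {ν : Measure Ω}
    [IsProbabilityMeasure ν] {X : Ω → ℝ} (hX : AEStronglyMeasurable X ν) (hpos : ∀ᵐ ω ∂ν, 0 ≤ X ω)
    (h2 : Integrable (fun ω => X ω ^ 2) ν) {K : ℝ} (hK : 0 < K) :
    |∫ ω, X ω ∂ν - ∫ ω, min |X ω| K ∂ν| ≤ (∫ ω, X ω ^ 2 ∂ν) / K := by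
  have hXi : Integrable X ν := ((memLp_two_iff_integrable_sq hX).mpr h2).integrable one_le_two
  have hmi : Integrable (fun ω => min |X ω| K) ν := hXi.abs.inf (integrable_const K)
  rw [← integral_sub hXi hmi, ← integral_div]
  refine abs_integral_le_integral_abs.trans
    (integral_mono_ae (hXi.sub hmi).abs (h2.div_const K) ?_)
  filter_upwards [hpos] with ω hω
  rw [abs_of_nonneg hω, abs_of_nonneg (sub_nonneg.mpr (min_le_left _ _)), le_div_iff₀ hK]
  rcases le_total (X ω) K with h | h
  · rw [min_eq_left h]; nlinarith
  · rw [min_eq_right h]; nlinarith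

/-- Bounded second moments turn convergence in distribution into convergence of means. -/
lemma tendsto_mean {Ω : Type*} [MeasurableSpace Ω] {Pr : Measure Ω}
    [IsProbabilityMeasure Pr] {Z : Ω → ℝ} {ι : Type*} {Ω' : ι → Type*}
    [∀ i, MeasurableSpace (Ω' i)] {ν : ∀ i, Measure (Ω' i)} [∀ i, IsProbabilityMeasure (ν i)]
    {X : ∀ i, Ω' i → ℝ} {l : Filter ι} [l.NeBot] (h : TendstoInDistribution X l Z ν Pr)
    (hX : ∀ i x, 0 ≤ X i x) (hX2 : ∀ i, Integrable (fun x => X i x ^ 2) (ν i))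
    (hZ2 : Integrable (fun ω => Z ω ^ 2) Pr) {S : ℝ}
    (hS : Tendsto (fun i => ∫ x, X i x ^ 2 ∂ν i) l (𝓝 S)) :
    Tendsto (fun i => ∫ x, X i x ∂ν i) l (𝓝 (∫ ω, Z ω ∂Pr)) := by
  rw [Metric.tendsto_nhds]
  intro ε hε
  set S' : ℝ := max (S + 1) (∫ ω, Z ω ^ 2 ∂Pr) + 1 with hS'
  have hb1 : S + 1 ≤ S' := by linarith [le_max_left (S + 1) (∫ ω, Z ω ^ 2 ∂Pr)]
  have hb2 : ∫ ω, Z ω ^ 2 ∂Pr ≤ S' := by linarith [le_max_right (S + 1) (∫ ω, Z ω ^ 2 ∂Pr)]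
  have hS'0 : 0 < S' := by
    have : 0 ≤ ∫ ω, Z ω ^ 2 ∂Pr := integral_nonneg fun _ => sq_nonneg _
    linarith [le_max_right (S + 1) (∫ ω, Z ω ^ 2 ∂Pr)]
  set K : ℝ := 4 * S' / ε with hKdef
  have hK : 0 < K := by positivity
  have hKe : S' / K = ε / 4 := by rw [hKdef]; field_simp
  let g : ℝ →ᵇ ℝ := BoundedContinuousFunction.ofNormedAddCommGroup
    (fun z => min |z| K) (by fun_prop) K (fun z => by
      rw [Real.norm_of_nonneg (le_min (abs_nonneg _) hK.le)]
      exact min_le_right _ _)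
  have h1 := tendsto_integral_of_tendstoInDistribution h g
  rw [Metric.tendsto_nhds] at h1
  have hZ := abs_integral_sub_truncation_le h.aemeasurable_limit.aestronglyMeasurable
    (ae_nonneg_of_tendstoInDistribution h hX) hZ2 hK
  have hZ' : |∫ ω, Z ω ∂Pr - ∫ ω, min |Z ω| K ∂Pr| ≤ ε / 4 :=
    hZ.trans (hKe ▸ div_le_div_of_nonneg_right hb2 hK.le)
  filter_upwards [h1 (ε / 4) (by positivity), hS.eventually_lt_const (lt_add_one S)] with i hi hSi
  have hXi := abs_integral_sub_truncation_le (h.forall_aemeasurable i).aestronglyMeasurable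
    (Eventually.of_forall (hX i)) (hX2 i) hK
  have hXi' : |∫ x, X i x ∂ν i - ∫ x, min |X i x| K ∂ν i| ≤ ε / 4 :=
    hXi.trans (hKe ▸ div_le_div_of_nonneg_right (by linarith) hK.le)
  rw [Real.dist_eq] at hi ⊢
  change |∫ x, min |X i x| K ∂ν i - ∫ ω, min |Z ω| K ∂Pr| < ε / 4 at hi
  rw [abs_lt] at hi ⊢
  rw [abs_le] at hXi' hZ'
  constructor <;> linarith [hi.1, hi.2, hXi'.1, hXi'.2, hZ'.1, hZ'.2]

/-- The bounded continuous function `z ↦ (|z| μ) ^ j * exp (-|z| μ)`. The absolute value makes it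
bounded on all of `ℝ` and is harmless for nonnegative random variables. -/
def poissonWeight (μ : ℝ) (hμ : 0 ≤ μ) (j : ℕ) : ℝ →ᵇ ℝ :=
  BoundedContinuousFunction.ofNormedAddCommGroup
    (fun z => (|z| * μ) ^ j * Real.exp (-(|z| * μ))) (by fun_prop) j.factorial (fun z => by
      have h0 : 0 ≤ |z| * μ := by positivity
      rw [Real.norm_of_nonneg (by positivity), Real.exp_neg, ← div_eq_mul_inv,
        div_le_iff₀ (Real.exp_pos _), mul_comm (j.factorial : ℝ)]
      have := Real.pow_div_factorial_le_exp _ h0 j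
      rwa [div_le_iff₀ (by positivity)] at this)

lemma poissonWeight_apply (μ : ℝ) (hμ : 0 ≤ μ) (j : ℕ) (z : ℝ) :
    poissonWeight μ hμ j z = (|z| * μ) ^ j * Real.exp (-(|z| * μ)) := rfl

lemma integral_poissonWeight {Ω : Type*} [MeasurableSpace Ω] {Pr : Measure Ω} {Z : Ω → ℝ}
    (hZ : ∀ᵐ ω ∂Pr, 0 ≤ Z ω) (hμ : 0 ≤ ∫ ω, Z ω ∂Pr) (j : ℕ) :
    ∫ ω, poissonWeight (∫ ω, Z ω ∂Pr) hμ j (Z ω) ∂Pr = j.factorial * mixedPoisson Pr Z j := by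
  rw [mixedPoisson, mul_inv_cancel_left₀ (by positivity)]
  refine integral_congr_ae ?_
  filter_upwards [hZ] with ω hω
  rw [poissonWeight_apply, abs_of_nonneg hω]

lemma mixedPoisson_pos {Ω : Type*} [MeasurableSpace Ω] {Pr : Measure Ω}
    [IsProbabilityMeasure Pr] {Z : Ω → ℝ} (hm : AEMeasurable Z Pr)
    (hZ : ∀ᵐ ω ∂Pr, 0 ≤ Z ω) (hμ : 0 < ∫ ω, Z ω ∂Pr) (k : ℕ) : 0 < mixedPoisson Pr Z k := by
  have h1 := integral_poissonWeight hZ hμ.le k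
  suffices h : 0 < ∫ ω, poissonWeight (∫ ω, Z ω ∂Pr) hμ.le k (Z ω) ∂Pr by
    rw [h1] at h
    exact pos_of_mul_pos_right h (by positivity)
  set g := poissonWeight (∫ ω, Z ω ∂Pr) hμ.le k
  have hnn : ∀ z, 0 ≤ g z := fun z => by
    rw [poissonWeight_apply]; positivity
  have hint : Integrable (fun ω => g (Z ω)) Pr :=
    Integrable.of_bound (g.continuous.measurable.comp_aemeasurable hm).aestronglyMeasurable ‖g‖
      (Eventually.of_forall fun ω => g.norm_coe_le_norm _)
  refine (integral_nonneg fun ω => hnn _).lt_of_ne fun h0 => ?_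
  have h2 := (integral_eq_zero_iff_of_nonneg (fun ω => hnn _) hint).mp h0.symm
  have h3 : ∫ ω, Z ω ∂Pr = 0 := by
    refine integral_eq_zero_of_ae ?_
    filter_upwards [h2, hZ] with ω h hω
    by_contra hne
    have : 0 < |Z ω| := abs_pos.mpr hne
    have hp : 0 < g (Z ω) := by
      rw [poissonWeight_apply]; positivity
    exact hp.ne' h
  exact hμ.ne' h3

end Distribution

/-! ### Averaging over the attribute set of the root -/

open scoped BoundedContinuousFunction

/-- The filter on pairs `(m, A)`, `A ⊆ Fin m`, of sets with exactly `y` joints as `m → ∞`. Limits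
along it are limits that are uniform over all such sets `A`. -/
def jointsFilter (s : ℕ → ℕ) (y : ℕ) : Filter (Σ m : ℕ, Finset (Fin m)) :=
  comap Sigma.fst atTop ⊓ 𝓟 {p | p.2.card.choose (s p.1) = y}

lemma tendsto_fst_jointsFilter (s : ℕ → ℕ) (y : ℕ) :
    Tendsto Sigma.fst (jointsFilter s y) atTop :=
  tendsto_comap.mono_left inf_le_left

lemma eventually_joints_eq (s : ℕ → ℕ) (y : ℕ) :
    ∀ᶠ p in jointsFilter s y, p.2.card.choose (s p.1) = y :=
  eventually_inf_principal.mpr (Eventually.of_forall fun _ hp => hp)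

lemma eventually_jointsFilter {s : ℕ → ℕ} {y : ℕ} {p : (m : ℕ) → Finset (Fin m) → Prop} :
    (∀ᶠ x in jointsFilter s y, p x.1 x.2) ↔
      ∀ᶠ m in atTop, ∀ A : Finset (Fin m), A.card.choose (s m) = y → p m A := by
  rw [jointsFilter, eventually_inf_principal, eventually_comap]
  refine eventually_congr (Eventually.of_forall fun m => ⟨fun h A hA => h ⟨m, A⟩ rfl hA, ?_⟩)
  rintro h ⟨m', A⟩ rfl hA
  exact h A hA

/-- The rescaling factor between the number of joints and `scaledJoints`. -/
def jointScale (n m s : ℕ) : ℝ := (Real.sqrt (m.choose s))⁻¹ * Real.sqrt n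

lemma jointScale_sq (n m s : ℕ) : jointScale n m s ^ 2 = n / m.choose s := by
  rw [jointScale, mul_pow, inv_pow, Real.sq_sqrt (Nat.cast_nonneg _),
    Real.sq_sqrt (Nat.cast_nonneg _), inv_mul_eq_div]

lemma tendsto_jointScale {n s : ℕ → ℕ} {β : ℝ} (hβ : 0 < β)
    (hratio : Tendsto (fun m : ℕ => (m.choose (s m) : ℝ) / (n m : ℝ)) atTop (𝓝 β)) :
    Tendsto (fun m => jointScale (n m) m (s m)) atTop (𝓝 (Real.sqrt β)⁻¹) := by
  have h := (hratio.sqrt).inv₀ (Real.sqrt_ne_zero'.mpr hβ)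
  refine h.congr fun m => ?_
  rw [jointScale, Real.sqrt_div (Nat.cast_nonneg _), inv_div, inv_mul_eq_div]

/-- If a bounded function `f m A` is asymptotically `g` of the rescaled number of joints of `A`,
uniformly over the sets with any fixed number of joints, then its mean converges to `𝔼 g(Z)`.
Sets with many joints are negligible by the second moment bound. -/
lemma tendsto_sum_weight {Ω : Type*} [MeasurableSpace Ω] {Pr : Measure Ω}
    [IsProbabilityMeasure Pr] {Z : Ω → ℝ} {n s : ℕ → ℕ} {P : (m : ℕ) → PMF (Fin (m + 1))} {β : ℝ}
    (hβ : 0 < β)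
    (hratio : Tendsto (fun m : ℕ => (m.choose (s m) : ℝ) / (n m : ℝ)) atTop (𝓝 β))
    (hconv : TendstoInDistribution (fun m => scaledJoints (n m) m (s m)) atTop Z
      (fun m => (P m).toMeasure) Pr) {S : ℝ}
    (hS : Tendsto (fun m => ∫ x, scaledJoints (n m) m (s m) x ^ 2 ∂(P m).toMeasure) atTop (𝓝 S))
    (f : (m : ℕ) → Finset (Fin m) → ℝ) (g : ℝ →ᵇ ℝ) (K : ℝ)
    (hf : ∀ᶠ m in atTop, ∀ A, |f m A| ≤ K)
    (hlim : ∀ y : ℕ, Tendsto (fun p : Σ m : ℕ, Finset (Fin m) => f p.1 p.2) (jointsFilter s y)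
      (𝓝 (g ((Real.sqrt β)⁻¹ * y)))) :
    Tendsto (fun m => ∑ A, weight (P m) A * f m A) atTop (𝓝 (∫ ω, g (Z ω) ∂Pr)) := by
  have hg := tendsto_integral_of_tendstoInDistribution hconv g
  simp only [← sum_weight_mul_size] at hg
  have hscale := tendsto_jointScale hβ hratio
  have hpt : ∀ y : ℕ, Tendsto (fun p : Σ m : ℕ, Finset (Fin m) => f p.1 p.2 -
      g (scaledJoints (n p.1) p.1 (s p.1) (size p.2))) (jointsFilter s y) (𝓝 0) := by
    intro y
    have h1 : Tendsto (fun p : Σ m : ℕ, Finset (Fin m) =>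
        g (jointScale (n p.1) p.1 (s p.1) * y)) (jointsFilter s y)
        (𝓝 (g ((Real.sqrt β)⁻¹ * y))) :=
      (g.continuous.tendsto _).comp
        ((hscale.comp (tendsto_fst_jointsFilter s y)).mul_const (y : ℝ))
    have h2 := (hlim y).sub h1
    rw [sub_self] at h2
    refine h2.congr' ?_
    filter_upwards [eventually_joints_eq s y] with p hp
    simp only [scaledJoints, jointScale, size, hp]
  suffices h : Tendsto (fun m => ∑ A, weight (P m) A *
      (f m A - g (scaledJoints (n m) m (s m) (size A)))) atTop (𝓝 0) by
    have := h.add hg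
    rw [zero_add] at this
    refine this.congr fun m => ?_
    rw [← Finset.sum_add_distrib]
    exact Finset.sum_congr rfl fun A _ => by ring
  -- the second moment of the number of joints
  have hY : Tendsto (fun m => ∑ A, weight (P m) A * (A.card.choose (s m) : ℝ) ^ 2) atTop
      (𝓝 (β * S)) := by
    have h1 := hratio.mul hS
    refine h1.congr' ?_
    filter_upwards [hratio.eventually_const_lt hβ] with m hm
    have hn : (n m : ℝ) ≠ 0 := fun h => by simp [h] at hm
    have hM : (m.choose (s m) : ℝ) ≠ 0 := fun h => by simp [h] at hm
    rw [← sum_weight_mul_size, Finset.mul_sum]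
    refine Finset.sum_congr rfl fun A _ => ?_
    have h2 : scaledJoints (n m) m (s m) (size A) ^ 2 =
        (n m : ℝ) / m.choose (s m) * (A.card.choose (s m) : ℝ) ^ 2 := by
      rw [← jointScale_sq, ← mul_pow]; rfl
    rw [h2]
    field_simp
  rw [Metric.tendsto_nhds]
  intro ε hε
  have hK0 : 0 ≤ K := by
    obtain ⟨m, hm⟩ := hf.exists
    exact (abs_nonneg _).trans (hm ∅)
  set K' : ℝ := K + ‖g‖ with hK'
  have hK'0 : 0 ≤ K' := add_nonneg hK0 (norm_nonneg g)
  set B : ℝ := |β * S| + 1 with hB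
  obtain ⟨L, hL⟩ := exists_nat_gt (K' * B * 4 / ε)
  have hall : ∀ᶠ m in atTop, ∀ y ∈ Finset.range (L + 1), ∀ A : Finset (Fin m),
      A.card.choose (s m) = y →
      |f m A - g (scaledJoints (n m) m (s m) (size A))| < ε / 4 := by
    rw [Filter.eventually_all_finset]
    intro y _
    have h1 := (Metric.tendsto_nhds.mp (hpt y)) (ε / 4) (by positivity)
    simp only [Real.dist_eq, sub_zero] at h1
    exact eventually_jointsFilter.mp h1
  filter_upwards [hall, hf, hY.eventually_lt_const
    (show β * S < B by linarith [le_abs_self (β * S)])] with m hm hfm hYm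
  have hLpos : (0 : ℝ) < (L : ℝ) + 1 := by positivity
  have hterm : ∀ A : Finset (Fin m), |f m A - g (scaledJoints (n m) m (s m) (size A))| ≤
      ε / 4 + K' / (L + 1) * (A.card.choose (s m) : ℝ) ^ 2 := by
    intro A
    by_cases hA : A.card.choose (s m) ≤ L
    · have := hm _ (Finset.mem_range.mpr (by omega)) A rfl
      have h0 : 0 ≤ K' / (L + 1) * (A.card.choose (s m) : ℝ) ^ 2 := by positivity
      linarith
    · have hA' : (L : ℝ) + 1 ≤ A.card.choose (s m) := by
        exact_mod_cast (by omega : L + 1 ≤ A.card.choose (s m))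
      have h1 : |f m A - g (scaledJoints (n m) m (s m) (size A))| ≤ K' :=
        (abs_sub _ _).trans (add_le_add (hfm A) (g.norm_coe_le_norm _))
      have h2 : (L : ℝ) + 1 ≤ (A.card.choose (s m) : ℝ) ^ 2 := by nlinarith
      have h3 : K' ≤ K' / (L + 1) * (A.card.choose (s m) : ℝ) ^ 2 := by
        calc K' = K' / (L + 1) * (L + 1) := by field_simp
          _ ≤ _ := by gcongr
      linarith
  rw [Real.dist_eq, sub_zero]
  calc |∑ A, weight (P m) A * (f m A - g (scaledJoints (n m) m (s m) (size A)))|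
      ≤ ∑ A, |weight (P m) A * (f m A - g (scaledJoints (n m) m (s m) (size A)))| :=
        Finset.abs_sum_le_sum_abs _ _
    _ ≤ ∑ A, weight (P m) A * (ε / 4 + K' / (L + 1) * (A.card.choose (s m) : ℝ) ^ 2) := by
        refine Finset.sum_le_sum fun A _ => ?_
        rw [abs_mul, abs_of_nonneg (weight_nonneg _ _)]
        exact mul_le_mul_of_nonneg_left (hterm A) (weight_nonneg _ _)
    _ = ε / 4 + K' / (L + 1) * ∑ A, weight (P m) A * (A.card.choose (s m) : ℝ) ^ 2 := by
        simp only [mul_add, Finset.sum_add_distrib, ← Finset.sum_mul, sum_weight, one_mul]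
        rw [Finset.mul_sum]
        congr 1
        exact Finset.sum_congr rfl fun A _ => by ring
    _ ≤ ε / 4 + K' / (L + 1) * B := by gcongr
    _ < ε := by
        have : K' / (L + 1) * B < ε / 2 := by
          rw [div_mul_eq_mul_div, div_lt_iff₀ hLpos]
          rw [div_lt_iff₀ hε] at hL
          nlinarith
        linarith

/-! ### Limits of the edge and triangle probabilities -/

lemma integral_scaledJoints (n m s : ℕ) (P : PMF (Fin (m + 1))) :
    ∫ x, scaledJoints n m s x ∂P.toMeasure =
      jointScale n m s * ∫ x : Fin (m + 1), ((x : ℕ).choose s : ℝ) ∂P.toMeasure := by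
  rw [← integral_const_mul]; rfl

lemma integral_scaledJoints_sq (n m s : ℕ) (P : PMF (Fin (m + 1))) :
    ∫ x, scaledJoints n m s x ^ 2 ∂P.toMeasure =
      (n / m.choose s : ℝ) * ∫ x : Fin (m + 1), ((x : ℕ).choose s : ℝ) ^ 2 ∂P.toMeasure := by
  rw [← integral_const_mul, ← jointScale_sq]
  simp only [← mul_pow]
  rfl

lemma tendsto_vertices {n s : ℕ → ℕ} {β : ℝ} (hβ : 0 < β)
    (hs_pos : ∀ m, 1 ≤ s m) (hs_bdd : ∃ C : ℕ, ∀ m, s m ≤ C)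
    (hratio : Tendsto (fun m : ℕ => (m.choose (s m) : ℝ) / (n m : ℝ)) atTop (𝓝 β)) :
    Tendsto n atTop atTop := by
  obtain ⟨C, hC⟩ := hs_bdd
  rw [← tendsto_natCast_atTop_iff (R := ℝ)]
  have h1 : Tendsto (fun m : ℕ => ((m : ℝ) - C) / (β + 1)) atTop atTop :=
    (tendsto_atTop_add_const_right _ (-(C : ℝ)) tendsto_natCast_atTop_atTop).atTop_div_const
      (by linarith)
  refine tendsto_atTop_mono' _ ?_ h1
  filter_upwards [hratio.eventually_const_lt hβ, hratio.eventually_lt_const (lt_add_one β)]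
    with m h0 h2
  have hn : (0 : ℝ) < n m := by
    rcases (Nat.cast_nonneg (n m) : (0 : ℝ) ≤ n m).eq_or_lt with h | h
    · rw [← h, div_zero] at h0; exact absurd h0 (lt_irrefl _)
    · exact h
  rw [div_lt_iff₀ hn] at h2
  rw [div_le_iff₀ (by linarith)]
  have h3 : (m : ℝ) - C ≤ m.choose (s m) := by
    have : m ≤ m.choose (s m) + C := by
      have := sub_le_choose (hs_pos m) m
      have := hC m
      omega
    have h4 : (m : ℝ) ≤ m.choose (s m) + C := by exact_mod_cast this
    linarith
  linarith

lemma tendsto_mul_meanContain {n s : ℕ → ℕ} {P : (m : ℕ) → PMF (Fin (m + 1))} {β μ : ℝ}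
    (hβ : 0 < β)
    (hratio : Tendsto (fun m : ℕ => (m.choose (s m) : ℝ) / (n m : ℝ)) atTop (𝓝 β))
    (hmean : Tendsto (fun m => ∫ x, scaledJoints (n m) m (s m) x ∂(P m).toMeasure) atTop (𝓝 μ)) :
    Tendsto (fun m => (n m : ℝ) * meanContain (P m) (s m)) atTop (𝓝 ((Real.sqrt β)⁻¹ * μ)) := by
  refine ((tendsto_jointScale hβ hratio).mul hmean).congr fun m => ?_
  rw [integral_scaledJoints, ← mul_assoc, ← sq, jointScale_sq, meanContain]
  ring

/-- The probability of containing a joint and one further attribute is `O(1 / (n m))`. -/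
lemma eventually_mul_meanContain_succ_le {n s : ℕ → ℕ} {P : (m : ℕ) → PMF (Fin (m + 1))} {S : ℝ}
    (hs_pos : ∀ m, 1 ≤ s m) (hs_bdd : ∃ C : ℕ, ∀ m, s m ≤ C)
    (hS : Tendsto (fun m => ∫ x, scaledJoints (n m) m (s m) x ^ 2 ∂(P m).toMeasure) atTop (𝓝 S)) :
    ∀ᶠ m : ℕ in atTop, (n m : ℝ) * meanContain (P m) (s m + 1) ≤ 2 * (S + 1) / m := by
  obtain ⟨C, hC⟩ := hs_bdd
  filter_upwards [hS.eventually_lt_const (lt_add_one S), eventually_ge_atTop (2 * C + 1)]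
    with m hSm hm
  have hCm := hC m
  have hsm : s m < m := by omega
  have hm0 : (0 : ℝ) < m := by exact_mod_cast (by omega : 0 < m)
  have hms : (m : ℝ) / 2 ≤ (m : ℝ) - s m := by
    have : (2 * s m : ℝ) ≤ m := by exact_mod_cast (by omega : 2 * s m ≤ m)
    linarith
  have hms0 : (0 : ℝ) < (m : ℝ) - s m := by linarith
  have hM : (0 : ℝ) < m.choose (s m) := by exact_mod_cast Nat.choose_pos hsm.le
  calc (n m : ℝ) * meanContain (P m) (s m + 1)
      ≤ n m * ((∫ x : Fin (m + 1), ((x : ℕ).choose (s m) : ℝ) ^ 2 ∂(P m).toMeasure) /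
        ((m.choose (s m) : ℝ) * ((m : ℝ) - s m))) := by
        gcongr
        exact meanContain_succ_le (P m) (hs_pos m) hsm
    _ = (∫ x, scaledJoints (n m) m (s m) x ^ 2 ∂(P m).toMeasure) / ((m : ℝ) - s m) := by
        rw [integral_scaledJoints_sq]
        field_simp
    _ ≤ (∫ x, scaledJoints (n m) m (s m) x ^ 2 ∂(P m).toMeasure) / ((m : ℝ) / 2) := by
        refine div_le_div_of_nonneg_left (integral_nonneg fun _ => sq_nonneg _) (by positivity) hms
    _ ≤ (S + 1) / ((m : ℝ) / 2) := by gcongr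
    _ = _ := by field_simp

lemma tendsto_mul_meanContain_succ {n s : ℕ → ℕ} {P : (m : ℕ) → PMF (Fin (m + 1))} {S : ℝ}
    (hs_pos : ∀ m, 1 ≤ s m) (hs_bdd : ∃ C : ℕ, ∀ m, s m ≤ C)
    (hS : Tendsto (fun m => ∫ x, scaledJoints (n m) m (s m) x ^ 2 ∂(P m).toMeasure) atTop (𝓝 S)) :
    Tendsto (fun m => (n m : ℝ) * meanContain (P m) (s m + 1)) atTop (𝓝 0) :=
  squeeze_zero'
    (Eventually.of_forall fun _ => mul_nonneg (Nat.cast_nonneg _) (meanContain_nonneg _ _))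
    (eventually_mul_meanContain_succ_le hs_pos hs_bdd hS)
    (tendsto_const_nhds.div_atTop tendsto_natCast_atTop_atTop)

lemma tendsto_mul_sq_meanContain_succ {n s : ℕ → ℕ} {P : (m : ℕ) → PMF (Fin (m + 1))} {S : ℝ}
    (hs_pos : ∀ m, 1 ≤ s m) (hs_bdd : ∃ C : ℕ, ∀ m, s m ≤ C)
    (hS : Tendsto (fun m => ∫ x, scaledJoints (n m) m (s m) x ^ 2 ∂(P m).toMeasure) atTop (𝓝 S)) :
    Tendsto (fun m : ℕ => (m : ℝ) * ((n m : ℝ) * meanContain (P m) (s m + 1)) ^ 2) atTop (𝓝 0) := by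
  have hlim : Tendsto (fun m : ℕ => (2 * (S + 1)) ^ 2 / (m : ℝ)) atTop (𝓝 0) :=
    tendsto_const_nhds.div_atTop tendsto_natCast_atTop_atTop
  refine squeeze_zero' (Eventually.of_forall fun m => by positivity) ?_ hlim
  filter_upwards [eventually_mul_meanContain_succ_le hs_pos hs_bdd hS, eventually_gt_atTop 0]
    with m h hm
  have hm0 : (0 : ℝ) < m := by exact_mod_cast hm
  have h0 : 0 ≤ (n m : ℝ) * meanContain (P m) (s m + 1) :=
    mul_nonneg (Nat.cast_nonneg _) (meanContain_nonneg _ _)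
  calc (m : ℝ) * ((n m : ℝ) * meanContain (P m) (s m + 1)) ^ 2
      ≤ m * (2 * (S + 1) / m) ^ 2 := by gcongr
    _ = _ := by field_simp

lemma tendsto_mul_edgeProb {n s : ℕ → ℕ} {P : (m : ℕ) → PMF (Fin (m + 1))} {c : ℝ}
    (h1 : Tendsto (fun m => (n m : ℝ) * meanContain (P m) (s m)) atTop (𝓝 c))
    (h2 : Tendsto (fun m => (n m : ℝ) * meanContain (P m) (s m + 1)) atTop (𝓝 0)) (y : ℕ) :
    Tendsto (fun p : Σ m : ℕ, Finset (Fin m) =>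
      (n p.1 : ℝ) * edgeProb (P p.1) (s p.1) p.2) (jointsFilter s y) (𝓝 (y * c)) := by
  have hfst := tendsto_fst_jointsFilter s y
  have hup := (h1.comp hfst).const_mul (y : ℝ)
  have hlo := hup.sub ((h2.comp hfst).const_mul ((y : ℝ) ^ 2))
  rw [mul_zero, sub_zero] at hlo
  refine tendsto_of_tendsto_of_tendsto_of_le_of_le' hlo hup ?_ ?_
  · filter_upwards [eventually_joints_eq s y] with p hp
    have := mul_le_mul_of_nonneg_left (le_edgeProb (P p.1) (s p.1) p.2)
      (Nat.cast_nonneg (α := ℝ) (n p.1))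
    rw [hp] at this
    refine le_trans (le_of_eq ?_) this
    simp only [Function.comp_apply]
    ring
  · filter_upwards [eventually_joints_eq s y] with p hp
    have := mul_le_mul_of_nonneg_left (edgeProb_le (P p.1) (s p.1) p.2)
      (Nat.cast_nonneg (α := ℝ) (n p.1))
    rw [hp] at this
    refine this.trans (le_of_eq ?_)
    simp only [Function.comp_apply]
    ring

lemma tendsto_mul_triangleProb {n s : ℕ → ℕ} {P : (m : ℕ) → PMF (Fin (m + 1))} {c : ℝ}
    (h1 : Tendsto (fun m => (n m : ℝ) * meanContain (P m) (s m)) atTop (𝓝 c))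
    (h2 : Tendsto (fun m => (n m : ℝ) * meanContain (P m) (s m + 1)) atTop (𝓝 0))
    (h3 : Tendsto (fun m : ℕ => (m : ℝ) * ((n m : ℝ) * meanContain (P m) (s m + 1)) ^ 2) atTop
      (𝓝 0)) (y : ℕ) :
    Tendsto (fun p : Σ m : ℕ, Finset (Fin m) =>
      (n p.1 : ℝ) ^ 2 * triangleProb (P p.1) (s p.1) p.2) (jointsFilter s y) (𝓝 (y * c ^ 2)) := by
  have hfst := tendsto_fst_jointsFilter s y
  have hmid := ((h1.comp hfst).pow 2).const_mul (y : ℝ)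
  have hlo := hmid.sub (((h2.comp hfst).pow 2).const_mul ((y : ℝ) ^ 2))
  have hup := hmid.add ((h3.comp hfst).const_mul ((y : ℝ) ^ 2))
  rw [zero_pow two_ne_zero, mul_zero, sub_zero] at hlo
  rw [mul_zero, add_zero] at hup
  refine tendsto_of_tendsto_of_tendsto_of_le_of_le' hlo hup ?_ ?_
  · filter_upwards [eventually_joints_eq s y] with p hp
    have := mul_le_mul_of_nonneg_left (le_triangleProb (P p.1) (s p.1) p.2)
      (sq_nonneg (n p.1 : ℝ))
    rw [hp] at this
    refine le_trans (le_of_eq ?_) this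
    simp only [Function.comp_apply]
    ring
  · filter_upwards [eventually_joints_eq s y] with p hp
    have := mul_le_mul_of_nonneg_left (triangleProb_le (P p.1) (s p.1) p.2)
      (sq_nonneg (n p.1 : ℝ))
    rw [hp] at this
    refine this.trans (le_of_eq ?_)
    simp only [Function.comp_apply]
    ring

/-! ### The cherry and triangle probabilities -/

/-- The averaged weight of a star: the root has `k` neighbours, `k - 2` of which are chosen among
`n - 3` vertices, and `r A` is the probability of the event concerning the other two. -/
def starMean {m : ℕ} (n s k : ℕ) (P : PMF (Fin (m + 1))) (r : Finset (Fin m) → ℝ) : ℝ :=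
  ((n - 3).choose (k - 2) : ℝ) * ∑ A, weight P A *
    (r A * (edgeProb P s A ^ (k - 2) * (1 - edgeProb P s A) ^ (n - 3 - (k - 2))))

lemma setsLaw_cherryEvent {n m : ℕ} (P : PMF (Fin (m + 1))) (s : ℕ) {k : ℕ} (hk : 2 ≤ k)
    {v v' v'' : Fin n} (h1 : v ≠ v') (h2 : v ≠ v'') (h3 : v' ≠ v'') :
    (setsLaw n m P).real (cherryEvent s k v v' v'') =
      starMean n s k P (fun A => edgeProb P s A ^ 2) := by
  have h := setsLaw_cherry P s hk h1 h2 h3 (fun _ _ => True)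
  rw [show {D : Fin n → Finset (Fin m) | True} = Set.univ from Set.ofPred_true,
    Set.inter_univ] at h
  rw [h, starMean]
  congr 1
  refine Finset.sum_congr rfl fun A _ => ?_
  simp only [and_true]
  rw [sum_pair_indicator P (fun B => s ≤ (A ∩ B).card) (fun B => s ≤ (A ∩ B).card), sq]
  rfl

lemma setsLaw_cherryEvent_inter_adj {n m : ℕ} (P : PMF (Fin (m + 1))) (s : ℕ) {k : ℕ} (hk : 2 ≤ k)
    {v v' v'' : Fin n} (h1 : v ≠ v') (h2 : v ≠ v'') (h3 : v' ≠ v'') :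
    (setsLaw n m P).real (cherryEvent s k v v' v'' ∩ {D | (graph s D).Adj v' v''}) =
      starMean n s k P (triangleProb P s) := by
  rw [starMean]
  simp only [triangleProb]
  rw [← setsLaw_cherry P s hk h1 h2 h3 (fun B C => s ≤ (B ∩ C).card)]
  congr 2
  ext D
  exact ⟨fun h => h.2, fun h => ⟨h3, h⟩⟩

lemma alphaDeg_eq {n m : ℕ} (P : PMF (Fin (m + 1))) (s : ℕ) {k : ℕ} (hk : 2 ≤ k)
    {v v' v'' : Fin n} (h1 : v ≠ v') (h2 : v ≠ v'') (h3 : v' ≠ v'') :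
    alphaDeg n m s P k v v' v'' =
      starMean n s k P (triangleProb P s) / starMean n s k P (fun A => edgeProb P s A ^ 2) := by
  rw [← setsLaw_cherryEvent P s hk h1 h2 h3, ← setsLaw_cherryEvent_inter_adj P s hk h1 h2 h3,
    alphaDeg, Measure.real, cond_apply (Set.toFinite _).measurableSet, ENNReal.toReal_mul,
    ENNReal.toReal_inv, mul_comm, ← div_eq_mul_inv]
  rfl

/-- With `c = μ / √β`, a star whose distinguished pair has probability `r A ~ n⁻² a_y`, when `A` has
`y` joints, has the Poisson limit `a_y (y c)^(k - 2) exp (-y c) / (k - 2)!`, averaged over the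
limit law of the rescaled number of joints. -/
lemma tendsto_starMean {Ω : Type*} [MeasurableSpace Ω] {Pr : Measure Ω}
    [IsProbabilityMeasure Pr] {Z : Ω → ℝ} {n s : ℕ → ℕ} {P : (m : ℕ) → PMF (Fin (m + 1))} {β : ℝ}
    (hβ : 0 < β)
    (hratio : Tendsto (fun m : ℕ => (m.choose (s m) : ℝ) / (n m : ℝ)) atTop (𝓝 β))
    (hconv : TendstoInDistribution (fun m => scaledJoints (n m) m (s m)) atTop Z
      (fun m => (P m).toMeasure) Pr) {S : ℝ}
    (hS : Tendsto (fun m => ∫ x, scaledJoints (n m) m (s m) x ^ 2 ∂(P m).toMeasure) atTop (𝓝 S))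
    (hn : Tendsto n atTop atTop) {k : ℕ} (hk : 2 ≤ k) {c : ℝ}
    (hedge : ∀ y : ℕ, Tendsto (fun p : Σ m : ℕ, Finset (Fin m) =>
      (n p.1 : ℝ) * edgeProb (P p.1) (s p.1) p.2) (jointsFilter s y) (𝓝 (y * c)))
    (r : (m : ℕ) → Finset (Fin m) → ℝ) (hr0 : ∀ m A, 0 ≤ r m A)
    (hr : ∀ m A, r m A ≤ edgeProb (P m) (s m) A ^ 2) (a : ℕ → ℝ)
    (hra : ∀ y : ℕ, Tendsto (fun p : Σ m : ℕ, Finset (Fin m) => (n p.1 : ℝ) ^ 2 * r p.1 p.2)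
      (jointsFilter s y) (𝓝 (a y))) (g : ℝ →ᵇ ℝ)
    (hg : ∀ y : ℕ, g ((Real.sqrt β)⁻¹ * y) = ((k - 2).factorial : ℝ)⁻¹ *
      (a y * ((y * c) ^ (k - 2) * Real.exp (-(y * c))))) :
    Tendsto (fun m => (n m : ℝ) ^ 2 * starMean (n m) (s m) k (P m) (r m)) atTop
      (𝓝 (∫ ω, g (Z ω) ∂Pr)) := by
  have h := tendsto_sum_weight hβ hratio hconv hS
    (fun m A => (n m : ℝ) ^ 2 * ((n m - 3).choose (k - 2) * (r m A *
      (edgeProb (P m) (s m) A ^ (k - 2) *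
        (1 - edgeProb (P m) (s m) A) ^ (n m - 3 - (k - 2)))))) g (2 ^ k * k.factorial) ?_ ?_
  · refine h.congr fun m => ?_
    rw [starMean, Finset.mul_sum, Finset.mul_sum]
    exact Finset.sum_congr rfl fun A _ => by ring
  · filter_upwards [hn.eventually_ge_atTop (2 * k + 2)] with m hm A
    have hq0 := edgeProb_nonneg (P m) (s m) A
    have hq1 := edgeProb_le_one (P m) (s m) A
    have hq1' : 0 ≤ 1 - edgeProb (P m) (s m) A := by linarith
    have := hr0 m A
    rw [abs_of_nonneg (by positivity)]
    refine le_trans ?_ (binomial_weight_le hk hm hq0 hq1)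
    gcongr
    exact hr m A
  · intro y
    have hnF := hn.comp (tendsto_fst_jointsFilter s y)
    have e1 := tendsto_choose_sub_div_pow hnF 3 (k - 2)
    have e2 := tendsto_one_sub_pow hnF (hedge y) (3 + (k - 2))
    rw [hg]
    refine (e1.mul ((hra y).mul (((hedge y).pow (k - 2)).mul e2))).congr' ?_
    filter_upwards [hnF.eventually_gt_atTop 0] with p hp
    have hp0 : (n p.1 : ℝ) ≠ 0 := by exact_mod_cast hp.ne'
    simp only [Function.comp_apply, Nat.sub_sub, mul_pow]
    field_simp

end ActiveGraph

end

open ActiveGraph in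
theorem theorem4 {Ω : Type*} [MeasurableSpace Ω] (Pr : Measure Ω) [IsProbabilityMeasure Pr]
    (Z : Ω → ℝ)
    (n s : ℕ → ℕ) (P : (m : ℕ) → PMF (Fin (m + 1))) (β : ℝ) (hβ : 0 < β)
    (hs_pos : ∀ m, 1 ≤ s m) (hs_bdd : ∃ C : ℕ, ∀ m, s m ≤ C)
    (hratio : Tendsto (fun m : ℕ => (m.choose (s m) : ℝ) / (n m : ℝ)) atTop (𝓝 β))
    (hconv : TendstoInDistribution (fun m => ActiveGraph.scaledJoints (n m) m (s m)) atTop Z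
      (fun m => (P m).toMeasure) Pr)
    (hZ_int : Integrable (fun ω => Z ω ^ 2) Pr)
    (hZ_pos : 0 < ∫ ω, Z ω ^ 2 ∂Pr)
    (hmoment : Tendsto
      (fun m => ∫ x, ActiveGraph.scaledJoints (n m) m (s m) x ^ 2 ∂(P m).toMeasure) atTop
      (𝓝 (∫ ω, Z ω ^ 2 ∂Pr))) :
    ∀ k : ℕ, 2 ≤ k →
      0 < ActiveGraph.mixedPoisson Pr Z k ∧
      ∀ ε : ℝ, 0 < ε → ∀ᶠ m in atTop, 3 ≤ n m ∧
        ∀ v v' v'' : Fin (n m), v ≠ v' → v ≠ v'' → v' ≠ v'' →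
          0 < ActiveGraph.setsLaw (n m) m (P m)
            (ActiveGraph.cherryEvent (s m) k v v' v'') ∧
          |ActiveGraph.alphaDeg (n m) m (s m) (P m) k v v' v'' -
            1 / (k : ℝ) * ((∫ ω, Z ω ∂Pr) / Real.sqrt β) *
              (ActiveGraph.mixedPoisson Pr Z (k - 1) / ActiveGraph.mixedPoisson Pr Z k)| < ε := by
  intro k hk
  have hX0 : ∀ m x, 0 ≤ scaledJoints (n m) m (s m) x := fun m x => by
    unfold scaledJoints; positivity
  have hZ0 := ae_nonneg_of_tendstoInDistribution hconv hX0
  have hZm := hconv.aemeasurable_limit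
  have hZi : Integrable Z Pr :=
    ((memLp_two_iff_integrable_sq hZm.aestronglyMeasurable).mpr hZ_int).integrable one_le_two
  have hμ : 0 < ∫ ω, Z ω ∂Pr := by
    refine (integral_nonneg_of_ae hZ0).lt_of_ne fun h0 => hZ_pos.ne' ?_
    have h1 := (integral_eq_zero_iff_of_nonneg_ae hZ0 hZi).mp h0.symm
    refine integral_eq_zero_of_ae ?_
    filter_upwards [h1] with ω hω
    simp only [Pi.zero_apply] at hω ⊢
    rw [hω, zero_pow two_ne_zero]
  have hpk : ∀ j, 0 < mixedPoisson Pr Z j := mixedPoisson_pos hZm hZ0 hμ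
  refine ⟨hpk k, ?_⟩
  have hmean := tendsto_mean hconv hX0 (fun m => Integrable.of_finite) hZ_int hmoment
  set μ := ∫ ω, Z ω ∂Pr with hμdef
  set b := (Real.sqrt β)⁻¹ with hb
  have hb0 : 0 < b := by positivity
  have hn := tendsto_vertices hβ hs_pos hs_bdd hratio
  have h1 := tendsto_mul_meanContain hβ hratio hmean
  have h2 := tendsto_mul_meanContain_succ hs_pos hs_bdd hmoment
  have h3 := tendsto_mul_sq_meanContain_succ hs_pos hs_bdd hmoment
  have hedge := tendsto_mul_edgeProb h1 h2
  have htri := tendsto_mul_triangleProb h1 h2 h3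
  obtain ⟨j, rfl⟩ : ∃ j, k = j + 2 := ⟨k - 2, by omega⟩
  have habs : ∀ y : ℕ, |b * (y : ℝ)| = b * y := fun y => abs_of_nonneg (by positivity)
  -- With `t = y b μ`, the two limits are `t ^ k e ^ (-t)` and `μ b t ^ (k - 1) e ^ (-t)`, up to the
  -- common factor `1 / (k - 2)!`.
  have hden := tendsto_starMean hβ hratio hconv hmoment hn hk hedge
    (fun m A => edgeProb (P m) (s m) A ^ 2) (fun _ _ => sq_nonneg _) (fun _ _ => le_rfl)
    (fun y => ((y : ℝ) * (b * μ)) ^ 2)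
    (fun y => by simpa only [mul_pow] using (hedge y).pow 2)
    ((j.factorial : ℝ)⁻¹ • poissonWeight μ hμ.le (j + 2)) (fun y => by
      simp only [← hb, BoundedContinuousFunction.coe_smul, poissonWeight_apply, habs, smul_eq_mul,
        Nat.add_sub_cancel]
      ring_nf)
  have hnum := tendsto_starMean hβ hratio hconv hmoment hn hk hedge
    (fun m A => triangleProb (P m) (s m) A) (fun _ _ => triangleProb_nonneg _ _ _)
    (fun _ _ => triangleProb_le_sq _ _ _) (fun y => (y : ℝ) * (b * μ) ^ 2) htri
    (((j.factorial : ℝ)⁻¹ * (μ * b)) • poissonWeight μ hμ.le (j + 1)) (fun y => by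
      simp only [← hb, BoundedContinuousFunction.coe_smul, poissonWeight_apply, habs, smul_eq_mul,
        Nat.add_sub_cancel]
      ring_nf)
  simp only [BoundedContinuousFunction.coe_smul, smul_eq_mul, integral_const_mul] at hden hnum
  rw [integral_poissonWeight hZ0 hμ.le] at hden hnum
  have hdenpos : 0 < (j.factorial : ℝ)⁻¹ * ((j + 2).factorial * mixedPoisson Pr Z (j + 2)) := by
    have := hpk (j + 2)
    positivity
  have hlim := hnum.div hden hdenpos.ne'
  have hval : (j.factorial : ℝ)⁻¹ * (μ * b) * ((j + 1).factorial * mixedPoisson Pr Z (j + 1)) /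
      ((j.factorial : ℝ)⁻¹ * ((j + 2).factorial * mixedPoisson Pr Z (j + 2))) =
      1 / ((j + 2 : ℕ) : ℝ) * (μ / Real.sqrt β) *
        (mixedPoisson Pr Z (j + 2 - 1) / mixedPoisson Pr Z (j + 2)) := by
    have hp := (hpk (j + 2)).ne'
    have hf : ((j + 1).factorial : ℝ) ≠ 0 := by positivity
    have hf' : (j.factorial : ℝ) ≠ 0 := by positivity
    have hβ' : Real.sqrt β ≠ 0 := (Real.sqrt_pos.mpr hβ).ne'
    have hj : ((j + 1 + 1 : ℕ) : ℝ) ≠ 0 := by positivity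
    rw [show j + 2 - 1 = j + 1 from rfl, Nat.factorial_succ (j + 1), Nat.cast_mul, hb]
    field_simp
  -- `hlim` concerns the ratio of the probabilities, from which the factors `n ^ 2` cancel.
  rw [hval] at hlim
  intro ε hε
  filter_upwards [(Metric.tendsto_nhds.mp hlim) ε hε, hden.eventually_const_lt hdenpos,
    hn.eventually_ge_atTop 3] with m hm hpos hn3
  refine ⟨hn3, fun v v' v'' hv1 hv2 hv3 => ⟨?_, ?_⟩⟩
  · rw [← setsLaw_cherryEvent (P m) (s m) hk hv1 hv2 hv3] at hpos
    have := pos_of_mul_pos_right hpos (by positivity)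
    exact (ENNReal.toReal_pos_iff.mp this).1
  · have hn0 : ((n m : ℝ)) ^ 2 ≠ 0 := by
      have : (0 : ℝ) < n m := by exact_mod_cast (by omega : 0 < n m)
      positivity
    rw [Real.dist_eq, Pi.div_apply, mul_div_mul_left _ _ hn0] at hm
    rwa [alphaDeg_eq (P m) (s m) hk hv1 hv2 hv3]
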